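/- **Setting.** Let $(\mathcal S,\mathcal A,P,\rho,\gamma,r_{1:m})$ be a finite Markov decision process with $|\mathcal A|\ge 2$, discount $\gamma\in(0,1)$, initial distribution $\rho$ and rewards $r_i:\mathcal S\times\mathcal A\to[0,1]$. For a stationary policy $\pi$ and a reward $r$ let $V^\pi_r(\rho)=\mathbb E[\sum_{t\ge0}\gamma^t r(s_t,a_t)]$ with $s_0\sim\rho$, $V^\pi_{1:m}(\rho)=(V^\pi_{r_1}(\rho),\dots,V^\pi_{r_m}(\rho))$, and let $d^\pi_\rho$ be the discounted (state, or state-action) visitation distribution. $D(x\|y)=\sum_i x_i\log(x_i/y_i)$, and $D_{d}(\pi\|\pi')=\sum_s d(s)D(\pi(\cdot|s)\|\pi'(\cdot|s))$. Policies are softmax policies $\pi_\theta(a|s)\propto e^{\theta_{s,a}}$, $\theta\in\mathbb R^{\mathcal S\times\mathcal A}$. Let $\Lambda$ be a nonempty closed convex subset of the simplex $\Delta([m])$, and let $\mathcal D\subseteq\mathbb R^m$ be a convex set containing all $V^{\pi_\theta}_{1:m}(\rho)$. Let $\Phi(v,\lambda)$ be concave in $v\in\mathcal D$ for each $\lambda\in\Lambda$,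 convex in $\lambda\in\Lambda$ for each $v\in\mathcal D$, with partial gradients on $\mathcal D\times\Delta([m])$, and $\beta$-smooth there ($\beta>0$) with respect to the norm $\|v\|_\infty+\|\lambda\|_1$, i.e. for all $(v,\lambda),(v',\lambda')\in\mathcal D\times\Delta([m])$, $$\max\{\|\nabla_v\Phi(v,\lambda)-\nabla_v\Phi(v',\lambda')\|_1,\ \|\nabla_\lambda\Phi(v,\lambda)-\nabla_\lambda\Phi(v',\lambda')\|_\infty\}\le\beta(\|v-v'\|_\infty+\|\lambda-\lambda'\|_1).$$ Let $L>0$ satisfy $\|\nabla_v\Phi\|_1\le L$ on $\mathcal D\times\Delta([m])$, and let $F(v)=\min_{\lambda\in\Lambda}\Phi(v,\lambda)$. **Algorithm (ARNPG-OMDA).** $\mathrm{InnerLoop}(\pi_{\theta_0},\tilde r,\alpha,\eta,t)$ starts at $\theta_0$ and performs $t$ natural policy gradient steps $\theta\leftarrow\theta+\eta\,\mathcal F_\rho(\theta)^\dagger\nabla_\theta\big[V^{\pi_\theta}_{\tilde r}(\rho)-\tfrac{\alpha}{1-\gamma}D_{d^{\pi_\theta}_\rho}(\pi_\theta\|\pi_{\theta_0})\big]$,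 where $\mathcal F_\rho(\theta)=\mathbb E_{(s,a)\sim d^{\pi_\theta}_\rho}[\nabla_\theta\log\pi_\theta(a|s)\nabla_\theta\log\pi_\theta(a|s)^\top]$ and $\dagger$ is the Moore–Penrose inverse. Start with $\pi_0=\tilde\pi_0$ the uniform policy and $\lambda_0=\tilde\lambda_0$ uniform on $[m]$. With $\tilde G^v_k=\nabla_v\Phi(V^{\tilde\pi_k}_{1:m}(\rho),\tilde\lambda_k)$, $\tilde G^\lambda_k=\nabla_\lambda\Phi(V^{\tilde\pi_k}_{1:m}(\rho),\tilde\lambda_k)$ and $\tilde r_k(s,a)=\langle\tilde G^v_k,r_{1:m}(s,a)\rangle$, for $k=0,\dots,K-1$ set $$\tilde\pi_{k+1}=\mathrm{InnerLoop}(\pi_k,\tilde r_k,\alpha,\eta,t_k),\qquad \tilde\lambda_{k+1}\in\arg\min_{\lambda\in\Lambda}\{\langle\tilde G^\lambda_k,\lambda\rangle+D(\lambda\|\lambda_k)/\eta'\},$$ $$\pi_{k+1}=\mathrm{InnerLoop}(\pi_k,\tilde r_{k+1},\alpha,\eta,t_k),\qquad \lambda_{k+1}\in\arg\min_{\lambda\in\Lambda}\{\langle\tilde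 G^\lambda_{k+1},\lambda\rangle+D(\lambda\|\lambda_k)/\eta'\}.$$ **Corollary.** For every $c\ge1$ there is a constant $C>0$ depending only on $c$, $|\mathcal A|$ and $m$ such that the following holds for every such instance and every $K\ge1$. Let $\frac{1}{6c\beta}\le\eta'\le\frac1{6\beta}$, $\frac{6\beta}{(1-\gamma)^3}\le\alpha\le\frac{6c\beta}{(1-\gamma)^3}$, $\eta=\frac{1-\gamma}\alpha$, and $t_k=\max\{0,\lceil\frac1{1-\gamma}\log\big(\frac{5LK}{6\beta\log|\mathcal A|}\big)+1\rceil\}$, and suppose that the total number of iterations $T=\sum_{k=0}^{K-1}2t_k$ is positive. Then for every stationary policy $\pi$ with $V^{\pi}_{1:m}(\rho)\in\mathcal D$, in particular for an optimal policy $\pi=\pi^*$, $$F\big(V^{\pi}_{1:m}(\rho)\big)-F\Big(\frac1K\sum_{k=1}^KV^{\tilde\pi_k}_{1:m}(\rho)\Big)\le C\,\big(1+\max\{0,\log(L/\beta)\}\big)\,\frac{\beta\log T}{(1-\gamma)^5\,T},$$ and if moreover $K\ge L/\beta$, then the left-hand side is at most $C\,\frac{\beta\log T}{(1-\gamma)^5T}$.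 -/

import Mathlib

open scoped BigOperators Matrix

namespace ARNPG

noncomputable section

/-! ### Finite-dimensional preliminaries -/

/-- The gradient (vector of partial derivatives) of a real function of finitely many real
variables. -/
def grad {ι : Type*} [Fintype ι] (f : (ι → ℝ) → ℝ) (x : ι → ℝ) : ι → ℝ :=
  open Classical in fun i => fderiv ℝ f x (Pi.single i 1)

/-- The `ℓ¹` norm on `ℝ^ι`. (The norm `‖·‖` of `ι → ℝ` is the `ℓ^∞` norm.) -/
def l1 {ι : Type*} [Fintype ι] (x : ι → ℝ) : ℝ := ∑ i, |x i|

/-- `D(x‖y) = ∑ x_i log (x_i / y_i)`, used only where the support of `x` is contained in that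
of `y`. -/
def kl {ι : Type*} [Fintype ι] (x y : ι → ℝ) : ℝ := ∑ i, x i * Real.log (x i / y i)

/-- The four Penrose equations for a real square matrix. -/
structure IsMoorePenrose {n : Type*} [Fintype n] (A B : Matrix n n ℝ) : Prop where
  mul_mul_self : A * B * A = A
  mul_mul_inv : B * A * B = B
  symm_left : (A * B)ᵀ = A * B
  symm_right : (B * A)ᵀ = B * A

theorem IsMoorePenrose.unique {n : Type*} [Fintype n] {A B C : Matrix n n ℝ}
    (hB : IsMoorePenrose A B) (hC : IsMoorePenrose A C) : B = C := by
  have h1 : A * B = A * C := by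
    calc A * B = (A * B)ᵀ := hB.symm_left.symm
      _ = ((A * C) * (A * B))ᵀ := by rw [← Matrix.mul_assoc, hC.mul_mul_self]
      _ = (A * B) * (A * C) := by rw [Matrix.transpose_mul, hB.symm_left, hC.symm_left]
      _ = A * C := by rw [← Matrix.mul_assoc, hB.mul_mul_self]
  have h2 : B * A = C * A := by
    calc B * A = (B * A)ᵀ := hB.symm_right.symm
      _ = ((B * A) * (C * A))ᵀ := by
          rw [Matrix.mul_assoc B A, ← Matrix.mul_assoc A C A, hC.mul_mul_self]
      _ = (C * A) * (B * A) := by rw [Matrix.transpose_mul, hB.symm_right, hC.symm_right]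
      _ = C * A := by rw [Matrix.mul_assoc C A, ← Matrix.mul_assoc A B A, hB.mul_mul_self]
  calc B = B * A * B := hB.mul_mul_inv.symm
    _ = C * (A * B) := by rw [h2, Matrix.mul_assoc]
    _ = C := by rw [h1, ← Matrix.mul_assoc, hC.mul_mul_inv]

/-- A symmetric matrix has a symmetric generalized inverse that commutes with it. -/
theorem exists_symm_ginv {n : Type*} [Fintype n] (H : Matrix n n ℝ) (hH : Hᵀ = H) :
    ∃ G : Matrix n n ℝ, Gᵀ = G ∧ G * H = H * G ∧ H * G * H = H ∧ G * H * G = G := by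
  classical
  have hh : H.IsHermitian := by
    rw [Matrix.IsHermitian, Matrix.conjTranspose_eq_transpose_of_trivial, hH]
  set U : Matrix n n ℝ := (hh.eigenvectorUnitary : Matrix n n ℝ) with hU
  have hUU : Uᵀ * U = 1 := by
    have := Unitary.star_mul_self_of_mem hh.eigenvectorUnitary.2
    rwa [Matrix.star_eq_conjTranspose, Matrix.conjTranspose_eq_transpose_of_trivial] at this
  have hspec : H = U * Matrix.diagonal hh.eigenvalues * Uᵀ := by
    have := hh.spectral_theorem
    rw [Unitary.conjStarAlgAut_apply, Matrix.star_eq_conjTranspose,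
      Matrix.conjTranspose_eq_transpose_of_trivial] at this
    simpa [Function.comp_def] using this
  clear_value U
  generalize hh.eigenvalues = d at hspec
  subst hspec
  have key : ∀ a b : n → ℝ, (U * Matrix.diagonal a * Uᵀ) * (U * Matrix.diagonal b * Uᵀ)
      = U * Matrix.diagonal (a * b) * Uᵀ := by
    intro a b
    calc _ = U * Matrix.diagonal a * (Uᵀ * U) * Matrix.diagonal b * Uᵀ := by
          simp only [Matrix.mul_assoc]
      _ = _ := by
          rw [hUU, Matrix.mul_one, Matrix.mul_assoc U, Matrix.diagonal_mul_diagonal]; rfl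
  refine ⟨U * Matrix.diagonal d⁻¹ * Uᵀ, ?_, ?_, ?_, ?_⟩
  · simp [Matrix.transpose_mul, Matrix.mul_assoc]
  · rw [key, key, mul_comm]
  · rw [key, key]
    congr 3
    ext i
    simp
  · rw [key, key]
    congr 3
    ext i
    by_cases h : d i = 0 <;> simp [h]

theorem exists_isMoorePenrose {n : Type*} [Fintype n] (A : Matrix n n ℝ) :
    ∃ B, IsMoorePenrose A B := by
  classical
  obtain ⟨G, hG, hc, h1, h2⟩ := exists_symm_ginv (Aᵀ * A) (by simp [Matrix.transpose_mul])
  have hA : A * G * (Aᵀ * A) = A := by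
    have hz : (A * (G * (Aᵀ * A)) - A)ᵀ * (A * (G * (Aᵀ * A)) - A) = 0 := by
      have e1 : (A * (G * (Aᵀ * A)) - A)ᵀ = (Aᵀ * A) * G * Aᵀ - Aᵀ := by
        simp [Matrix.transpose_mul, hG, Matrix.mul_assoc]
      have e2 : ((Aᵀ * A) * G * Aᵀ - Aᵀ) * (A * (G * (Aᵀ * A)) - A)
          = ((Aᵀ * A) * G * (Aᵀ * A)) * G * (Aᵀ * A) - (Aᵀ * A) * G * (Aᵀ * A)
            - ((Aᵀ * A) * G * (Aᵀ * A) - Aᵀ * A) := by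
        simp only [Matrix.sub_mul, Matrix.mul_sub, Matrix.mul_assoc]
      rw [e1, e2, h1, h1]; simp
    rw [← Matrix.conjTranspose_eq_transpose_of_trivial,
      Matrix.conjTranspose_mul_self_eq_zero, sub_eq_zero] at hz
    rw [Matrix.mul_assoc]; exact hz
  refine ⟨G * Aᵀ, ?_, ?_, ?_, ?_⟩
  · simpa [Matrix.mul_assoc] using hA
  · have : G * Aᵀ * A * (G * Aᵀ) = (G * (Aᵀ * A) * G) * Aᵀ := by simp only [Matrix.mul_assoc]
    rw [this, h2]
  · simp [Matrix.transpose_mul, hG, Matrix.mul_assoc]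
  · rw [Matrix.mul_assoc, Matrix.transpose_mul, hG]
    simp only [Matrix.transpose_mul, Matrix.transpose_transpose]
    exact hc.symm

/-- The Moore–Penrose inverse `A†`. -/
def pinv {n : Type*} [Fintype n] (A : Matrix n n ℝ) : Matrix n n ℝ :=
  (exists_isMoorePenrose A).choose

/-! ### Multi-objective Markov decision processes -/

/-- A finite discounted MDP `(S, A, P, ρ, γ, r_{1:m})` with `m` rewards valued in `[0,1]`. -/
structure MOMDP (S A : Type*) [Fintype S] [Fintype A] (m : ℕ) where
  /-- transition kernel: `P s a s'` is the probability of moving to `s'` -/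
  P : S → A → S → ℝ
  P_mem : ∀ s a, P s a ∈ stdSimplex ℝ S
  /-- initial state distribution -/
  ρ : S → ℝ
  ρ_mem : ρ ∈ stdSimplex ℝ S
  /-- discount factor -/
  γ : ℝ
  γ_pos : 0 < γ
  γ_lt_one : γ < 1
  /-- rewards -/
  r : Fin m → S → A → ℝ
  r_mem : ∀ i s a, r i s a ∈ Set.Icc (0 : ℝ) 1

/-- `π` is a stationary randomized policy. -/
def IsPolicy {S A : Type*} [Fintype A] (π : S → A → ℝ) : Prop := ∀ s, π s ∈ stdSimplex ℝ A

/-- The softmax policy `π_θ(a|s) = exp θ_{s,a} / ∑_{a'} exp θ_{s,a'}`. -/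
def softmax {S A : Type*} [Fintype A] (θ : S × A → ℝ) : S → A → ℝ :=
  fun s a => Real.exp (θ (s, a)) / ∑ a', Real.exp (θ (s, a'))

namespace MOMDP

variable {S A : Type*} [Fintype S] [Fintype A] {m : ℕ} (M : MOMDP S A m)

/-- `ℙ(s_t = s)` for the Markov chain started from `ρ` and run under the policy `π`. -/
def stateProb (π : S → A → ℝ) : ℕ → S → ℝ
  | 0 => M.ρ
  | t + 1 => fun s' => ∑ s, ∑ a, stateProb π t s * π s a * M.P s a s'

/-- The value `V^π_r(ρ) = ∑_t γ^t 𝔼[r(s_t,a_t)]` for an arbitrary reward function `r`. -/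
def value (π : S → A → ℝ) (r : S → A → ℝ) : ℝ :=
  ∑' t : ℕ, M.γ ^ t * ∑ s, ∑ a, M.stateProb π t s * π s a * r s a

/-- The value vector `V^π_{1:m}(ρ)`. -/
def valueVec (π : S → A → ℝ) : Fin m → ℝ := fun i => M.value π (M.r i)

/-- Discounted state-action visitation distribution
`d^π_ρ(s,a) = (1-γ) ∑_t γ^t ℙ(s_t = s, a_t = a)`. -/
def saVisit (π : S → A → ℝ) (s : S) (a : A) : ℝ :=
  (1 - M.γ) * ∑' t : ℕ, M.γ ^ t * (M.stateProb π t s * π s a)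

/-- Discounted state visitation distribution `d^π_ρ(s) = (1-γ) ∑_t γ^t ℙ(s_t = s)`. -/
def sVisit (π : S → A → ℝ) (s : S) : ℝ :=
  (1 - M.γ) * ∑' t : ℕ, M.γ ^ t * M.stateProb π t s

/-- `D_d(π‖π') = ∑_s d(s) D(π(·|s)‖π'(·|s))` with `d = d^π_ρ`. -/
def policyKL (π π' : S → A → ℝ) : ℝ := ∑ s, M.sVisit π s * kl (π s) (π' s)

/-- The KL-regularized value `V^{π_θ}_r(ρ) - α D_{d^{π_θ}_ρ}(π_θ‖π_{θ₀}) / (1-γ)` with anchor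
`π_{θ₀}`, as a function of the parameter `θ`. -/
def regValue (r : S → A → ℝ) (α : ℝ) (θ₀ θ : S × A → ℝ) : ℝ :=
  M.value (softmax θ) r - α * M.policyKL (softmax θ) (softmax θ₀) / (1 - M.γ)

/-- The Fisher information matrix
`𝔼_{(s,a) ∼ d^{π_θ}_ρ}[∇_θ log π_θ(a|s) (∇_θ log π_θ(a|s))ᵀ]`. -/
def fisher (θ : S × A → ℝ) : Matrix (S × A) (S × A) ℝ :=
  ∑ s, ∑ a, M.saVisit (softmax θ) s a •
    Matrix.vecMulVec (grad (fun θ' => Real.log (softmax θ' s a)) θ)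
      (grad (fun θ' => Real.log (softmax θ' s a)) θ)

/-- One natural policy gradient step on the regularized value. -/
def npgStep (r : S → A → ℝ) (α η : ℝ) (θ₀ θ : S × A → ℝ) : S × A → ℝ :=
  θ + η • (pinv (M.fisher θ) *ᵥ grad (M.regValue r α θ₀) θ)

/-- `InnerLoop`: `t` natural policy gradient steps started from the anchor `θ₀`. -/
def innerLoop (θ₀ : S × A → ℝ) (r : S → A → ℝ) (α η : ℝ) (t : ℕ) : S × A → ℝ :=
  (M.npgStep r α η θ₀)^[t] θ₀

end MOMDP

/-! ### The max-min criterion and the algorithm -/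

/-- `∇_v Φ(v, l)`. -/
def gradV {m : ℕ} (Φ : (Fin m → ℝ) → (Fin m → ℝ) → ℝ) (v l : Fin m → ℝ) : Fin m → ℝ :=
  grad (fun v' => Φ v' l) v

/-- `∇_λ Φ(v, l)`. -/
def gradL {m : ℕ} (Φ : (Fin m → ℝ) → (Fin m → ℝ) → ℝ) (v l : Fin m → ℝ) : Fin m → ℝ :=
  grad (fun l' => Φ v l') l

/-- `F(v) = min_{l ∈ Λ} Φ(v, l)`. -/
def minOver {m : ℕ} (Φ : (Fin m → ℝ) → (Fin m → ℝ) → ℝ) (Λ : Set (Fin m → ℝ))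
    (v : Fin m → ℝ) : ℝ := sInf ((fun l => Φ v l) '' Λ)

/-- The standing assumptions on the criterion `Φ`, the dual set `Λ` and the convex domain `D` of
value vectors: `Λ` is a nonempty closed convex subset of the simplex `Δ`, `Φ` is concave in `v`
and convex in `l`, has partial gradients on `D × Δ`, and is `β`-smooth there with respect to the
norm `‖v‖_∞ + ‖l‖₁`, whose dual norm is `max (‖v‖₁, ‖l‖_∞)`. -/
structure IsCriterion {m : ℕ} (Φ : (Fin m → ℝ) → (Fin m → ℝ) → ℝ)
    (D Λ : Set (Fin m → ℝ)) (β : ℝ) : Prop where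
  dom_convex : Convex ℝ D
  dual_subset : Λ ⊆ stdSimplex ℝ (Fin m)
  dual_nonempty : Λ.Nonempty
  dual_closed : IsClosed Λ
  dual_convex : Convex ℝ Λ
  concave : ∀ l ∈ Λ, ConcaveOn ℝ D (fun v => Φ v l)
  convex : ∀ v ∈ D, ConvexOn ℝ Λ (fun l => Φ v l)
  diff_v : ∀ v ∈ D, ∀ l ∈ stdSimplex ℝ (Fin m), DifferentiableAt ℝ (fun v' => Φ v' l) v
  diff_l : ∀ v ∈ D, ∀ l ∈ stdSimplex ℝ (Fin m), DifferentiableAt ℝ (fun l' => Φ v l') l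
  smooth : ∀ v ∈ D, ∀ l ∈ stdSimplex ℝ (Fin m), ∀ v' ∈ D, ∀ l' ∈ stdSimplex ℝ (Fin m),
    max (l1 (gradV Φ v l - gradV Φ v' l')) ‖gradL Φ v l - gradL Φ v' l'‖
      ≤ β * (‖v - v'‖ + l1 (l - l'))

/-- The reward in the ascent direction, `r̃(s,a) = ⟨∇_v Φ(V^π_{1:m}(ρ), l), r_{1:m}(s,a)⟩`. -/
def ascentReward {S A : Type*} [Fintype S] [Fintype A] {m : ℕ} (M : MOMDP S A m)
    (Φ : (Fin m → ℝ) → (Fin m → ℝ) → ℝ) (π : S → A → ℝ) (l : Fin m → ℝ) : S → A → ℝ :=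
  fun s a => ∑ i, gradV Φ (M.valueVec π) l i * M.r i s a

/-- The mirror descent objective `⟨g, l⟩ + D(l‖l₀) / η'`. -/
def dualObjective {m : ℕ} (g l₀ : Fin m → ℝ) (η' : ℝ) (l : Fin m → ℝ) : ℝ :=
  ∑ i, g i * l i + kl l l₀ / η'

/-- `l` is a point of `argmin_{l ∈ Λ} {⟨g, l⟩ + D(l‖l₀) / η'}`. -/
def IsDualStep {m : ℕ} (Λ : Set (Fin m → ℝ)) (g l₀ : Fin m → ℝ) (η' : ℝ) (l : Fin m → ℝ) : Prop :=
  l ∈ Λ ∧ IsMinOn (dualObjective g l₀ η') Λ l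

/-- `(θ_k, θ̃_k, λ_k, λ̃_k)`, `0 ≤ k ≤ K`, is the run of ARNPG-OMDA with `K` macro steps, uniform
initial policy, and numbers of micro steps `t_0, …, t_{K-1}`. -/
structure IsRun {S A : Type*} [Fintype S] [Fintype A] {m : ℕ} (M : MOMDP S A m)
    (Φ : (Fin m → ℝ) → (Fin m → ℝ) → ℝ) (Λ : Set (Fin m → ℝ)) (η' α η : ℝ) (t : ℕ → ℕ) (K : ℕ)
    (θ θt : ℕ → S × A → ℝ) (lam lamt : ℕ → Fin m → ℝ) : Prop where
  init_uniform : ∀ s a, softmax (θ 0) s a = 1 / (Fintype.card A : ℝ)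
  init_tilde : θt 0 = θ 0
  init_lam : lam 0 = fun _ => 1 / (m : ℝ)
  init_lamt : lamt 0 = fun _ => 1 / (m : ℝ)
  step_tilde : ∀ k < K, θt (k + 1) =
    M.innerLoop (θ k) (ascentReward M Φ (softmax (θt k)) (lamt k)) α η (t k)
  step_lamt : ∀ k < K,
    IsDualStep Λ (gradL Φ (M.valueVec (softmax (θt k))) (lamt k)) (lam k) η' (lamt (k + 1))
  step : ∀ k < K, θ (k + 1) =
    M.innerLoop (θ k) (ascentReward M Φ (softmax (θt (k + 1))) (lamt (k + 1))) α η (t k)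
  step_lam : ∀ k < K,
    IsDualStep Λ (gradL Φ (M.valueVec (softmax (θt (k + 1)))) (lamt (k + 1))) (lam k) η'
      (lam (k + 1))

/-- The prescribed number of micro steps
`⌈(1/(1-γ)) log (5 L K / (6 β log |A|)) + 1⌉` (and no step if this is negative). -/
def microSteps (γ L β : ℝ) (nA K : ℕ) : ℕ :=
  ⌈1 / (1 - γ) * Real.log (5 * L * K / (6 * β * Real.log nA)) + 1⌉₊

end

end ARNPG

namespace ARNPG

open Finset Filter Topology

/-! ### Relative entropy -/

/-! The run is an extragradient (optimistic mirror descent) method for a saddle problem that is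
concave-convex in the pair (value vector, dual variable), though not in the policy parameters.

Nonconvexity is harmless for two reasons. By `npgStep_apply`, a natural gradient step with `η = (1 -
γ) / α` is, on reachable states, exactly a step of soft policy iteration, so its output is a Gibbs
tilt of the anchor and the loop contracts like `γ ^ n`. By the performance difference identity
`value_sub` with a free baseline, the Gibbs identity integrates to the following: `(1 - γ) V^π - α
D(π‖anchor) + α D(π‖output)` is the same for all policies `π` up to an error of order `γ ^ n`. This
is `innerLoop_spec`; evaluating it at two policies gives the three-point inequality of mirror
descent (`innerLoop_three_point`). The exact dual analogue is `IsDualStep.three_point`.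

Pinsker's inequality shows that the policy divergence dominates the squared change of the value
vector (`value_sub_sq_le`). The bounds on `α` and `η'` turn both divergences into quadratic terms
with coefficient `3β`, which absorb the gradient variation allowed by `β`-smoothness; what remains
telescopes (`IsRun.step_regret_le`). Convexity turns the regret into a gap of order `β / ((1 - γ) ^
4 K)`, the prescribed number of micro steps making the accumulated inner errors of the same order.
Since `T` is `2 K` times that number, which is logarithmic over `1 - γ`, the rate in `T` follows. -/

theorem sub_mul_div_le_log {x : ℝ} (hx : 0 < x) :
    (x - 1) * (5 * x + 1) / (2 * x * (x + 2)) ≤ Real.log x := by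
  -- The rational function is chosen so that the difference has a derivative with the sign of `y -
  -- 1`; its minimum is therefore the value `0` at `1`.
  set f : ℝ → ℝ := fun x => Real.log x - (x - 1) * (5 * x + 1) / (2 * x * (x + 2)) with hf
  have hd : ∀ y : ℝ, 0 < y → HasDerivAt f ((y - 1) ^ 3 / (y ^ 2 * (y + 2) ^ 2)) y := by
    intro y hy
    have h2 : HasDerivAt (fun x : ℝ => (x - 1) * (5 * x + 1)) (1 * (5 * y + 1) + (y - 1) * 5) y :=
      ((hasDerivAt_id y).sub_const 1).mul
        (by simpa using ((hasDerivAt_id y).const_mul 5).add_const 1)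
    have h3 : HasDerivAt (fun x : ℝ => 2 * x * (x + 2)) (2 * (y + 2) + 2 * y * 1) y :=
      (by simpa using (hasDerivAt_id y).const_mul 2 : HasDerivAt (fun x : ℝ => 2 * x) 2 y).mul
        ((hasDerivAt_id y).add_const 2)
    have h4 : 2 * y * (y + 2) ≠ 0 := by positivity
    refine ((Real.hasDerivAt_log hy.ne').sub (h2.div h3 h4)).congr_deriv ?_
    field_simp
    ring
  have hc : ∀ s ⊆ Set.Ioi (0 : ℝ), ContinuousOn f s := fun s hs y hy =>
    (hd y (hs hy)).continuousAt.continuousWithinAt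
  have h1 : f 1 = 0 := by simp [hf]
  have : 0 ≤ f x := by
    rcases le_total x 1 with h | h
    · have : AntitoneOn f (Set.Icc x 1) := by
        refine antitoneOn_of_hasDerivWithinAt_nonpos (convex_Icc _ _)
          (hc _ fun y hy => hx.trans_le hy.1)
          (fun y hy => (hd y ?_).hasDerivWithinAt) (fun y hy => ?_)
        · rw [interior_Icc] at hy; exact hx.trans hy.1
        · rw [interior_Icc] at hy
          have : (y - 1) ^ 3 ≤ 0 := Odd.pow_nonpos (by decide) (by linarith [hy.2])
          exact div_nonpos_of_nonpos_of_nonneg this (by positivity)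
      simpa [h1] using this ⟨le_rfl, h⟩ ⟨h, le_rfl⟩ h
    · have : MonotoneOn f (Set.Icc 1 x) := by
        refine monotoneOn_of_hasDerivWithinAt_nonneg (convex_Icc _ _)
          (hc _ fun y hy => zero_lt_one.trans_le hy.1)
          (fun y hy => (hd y ?_).hasDerivWithinAt) (fun y hy => ?_)
        · rw [interior_Icc] at hy; exact zero_lt_one.trans hy.1
        · rw [interior_Icc] at hy
          have : 0 ≤ y - 1 := by linarith [hy.1]
          positivity
      simpa [h1] using this ⟨le_rfl, h⟩ ⟨h, le_rfl⟩ h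
  simpa [hf] using this

theorem le_mul_log_div {x y : ℝ} (hx : 0 ≤ x) (hy : 0 ≤ y) (h : y = 0 → x = 0) :
    x - y + 3 / 2 * ((x - y) ^ 2 / (x + 2 * y)) ≤ x * Real.log (x / y) := by
  rcases hx.eq_or_lt with rfl | hx
  · rcases hy.eq_or_lt with rfl | hy
    · simp
    · simp; field_simp; norm_num
  have hy : 0 < y := hy.lt_of_ne fun e => hx.ne' (h e.symm)
  have := mul_le_mul_of_nonneg_left (sub_mul_div_le_log (div_pos hx hy)) hx.le
  refine le_trans (le_of_eq ?_) this
  field_simp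
  ring

section
variable {ι : Type*} [Fintype ι]

/-- Pinsker's inequality. In `le_mul_log_div` the linear parts cancel on summation, and
Cauchy–Schwarz with the weights `x i + 2 * y i`, of total mass `3`, turns `3 / 2` into the sharp
constant. -/
theorem l1_sq_le_two_mul_kl {x y : ι → ℝ} (hx : x ∈ stdSimplex ℝ ι) (hy : y ∈ stdSimplex ℝ ι)
    (h : ∀ i, y i = 0 → x i = 0) : l1 (x - y) ^ 2 ≤ 2 * kl x y := by
  have h1 : ∑ i, (x i - y i + 3 / 2 * ((x i - y i) ^ 2 / (x i + 2 * y i))) ≤ kl x y :=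
    sum_le_sum fun i _ => le_mul_log_div (hx.1 i) (hy.1 i) (h i)
  rw [sum_add_distrib, sum_sub_distrib, hx.2, hy.2, ← mul_sum] at h1
  have h2 : (∑ i, |x i - y i|) ^ 2
      ≤ (∑ i, (x i - y i) ^ 2 / (x i + 2 * y i)) * ∑ i, (x i + 2 * y i) := by
    have hp : ∀ i, 0 ≤ x i + 2 * y i := fun i => by linarith [hx.1 i, hy.1 i]
    refine sum_sq_le_sum_mul_sum_of_sq_le_mul _ (fun i _ => div_nonneg (sq_nonneg _) (hp i))
      (fun i _ => hp i) fun i _ => ?_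
    rw [sq_abs]
    rcases (hp i).eq_or_lt with h0 | h0
    · have : y i = 0 := by linarith [hx.1 i, hy.1 i]
      simp [this, h i this]
    · rw [div_mul_cancel₀ _ h0.ne']
  rw [sum_add_distrib, ← mul_sum, hx.2, hy.2] at h2
  change (∑ i, |x i - y i|) ^ 2 ≤ _
  linarith

theorem kl_nonneg {x y : ι → ℝ} (hx : x ∈ stdSimplex ℝ ι) (hy : y ∈ stdSimplex ℝ ι)
    (h : ∀ i, y i = 0 → x i = 0) : 0 ≤ kl x y := by
  nlinarith [l1_sq_le_two_mul_kl hx hy h, sq_nonneg (l1 (x - y))]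

theorem kl_self (x : ι → ℝ) : kl x x = 0 :=
  sum_eq_zero fun i _ => by by_cases h : x i = 0 <;> simp [h]

theorem kl_eq_add {x y z : ι → ℝ} (h : ∀ i, x i ≠ 0 → y i ≠ 0 ∧ z i ≠ 0) :
    kl x y = kl x z + ∑ i, x i * Real.log (z i / y i) := by
  rw [kl, kl, ← sum_add_distrib]
  refine sum_congr rfl fun i _ => ?_
  by_cases hi : x i = 0
  · simp [hi]
  · obtain ⟨h1, h2⟩ := h i hi
    rw [← mul_add, ← Real.log_mul (div_ne_zero hi h2) (div_ne_zero h2 h1)]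
    congr 2
    field_simp

theorem kl_uniform_le {x y : ι → ℝ} (hx : x ∈ stdSimplex ℝ ι)
    (hy : ∀ i, y i = 1 / (Fintype.card ι : ℝ)) : kl x y ≤ Real.log (Fintype.card ι) := by
  have hle : ∀ i, x i ≤ 1 := fun i => by
    rw [← hx.2]; exact single_le_sum (fun j _ => hx.1 j) (mem_univ i)
  have : ∀ i, x i * Real.log (x i / y i) ≤ x i * Real.log (Fintype.card ι) := by
    intro i
    have : Nonempty ι := ⟨i⟩
    have hc : (0 : ℝ) < Fintype.card ι := by exact_mod_cast Fintype.card_pos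
    rcases (hx.1 i).eq_or_lt with h | h
    · simp [← h]
    · refine mul_le_mul_of_nonneg_left
        (Real.log_le_log (div_pos h (by rw [hy]; positivity)) ?_) h.le
      rw [hy]; field_simp; nlinarith [hle i]
  calc kl x y ≤ ∑ i, x i * Real.log (Fintype.card ι) := sum_le_sum fun i _ => this i
    _ = _ := by rw [← sum_mul, hx.2, one_mul]

/-- The compensation identity. It is exact, so strong convexity of the divergence can be used on the
boundary of the simplex, where the entropy is not differentiable. -/
theorem kl_convexComb {u l y : ι → ℝ} (hu : ∀ i, 0 ≤ u i) (hl : ∀ i, 0 ≤ l i)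
    (huy : ∀ i, y i = 0 → u i = 0) (hly : ∀ i, y i = 0 → l i = 0) {τ : ℝ} (h0 : 0 < τ)
    (h1 : τ < 1) :
    kl ((1 - τ) • u + τ • l) y = (1 - τ) * (kl u y - kl u ((1 - τ) • u + τ • l))
      + τ * (kl l y - kl l ((1 - τ) • u + τ • l)) := by
  have e1 : ∀ i, u i ≠ 0 → ((1 - τ) • u + τ • l) i ≠ 0 := fun i hi => by
    have : 0 < (1 - τ) * u i := mul_pos (by linarith) ((hu i).lt_of_ne hi.symm)
    have := mul_nonneg h0.le (hl i)
    simp; linarith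
  have e2 : ∀ i, l i ≠ 0 → ((1 - τ) • u + τ • l) i ≠ 0 := fun i hi => by
    have : 0 < τ * l i := mul_pos (by linarith) ((hl i).lt_of_ne hi.symm)
    have := mul_nonneg (by linarith : 0 ≤ 1 - τ) (hu i)
    simp; linarith
  rw [kl_eq_add (x := u) (y := y) fun i hi => ⟨fun h => hi (huy i h), e1 i hi⟩,
    kl_eq_add (x := l) (y := y) fun i hi => ⟨fun h => hi (hly i h), e2 i hi⟩, add_sub_cancel_left,
    add_sub_cancel_left, mul_sum, mul_sum, ← sum_add_distrib, kl]
  refine sum_congr rfl fun i _ => ?_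
  simp only [Pi.add_apply, Pi.smul_apply, smul_eq_mul]
  ring

end

/-! ### The mirror descent step on the dual variable -/

section
variable {m : ℕ} {Λ : Set (Fin m → ℝ)} {g l₀ u : Fin m → ℝ} {η' : ℝ}

/-- First-order optimality without derivatives: compare `u` with a point of the segment towards `l`,
expand by `kl_convexComb`, drop the divergence of `u`, and divide by `τ`. -/
theorem IsDualStep.kl_segment_le (hΛ : Λ ⊆ stdSimplex ℝ (Fin m)) (hconv : Convex ℝ Λ)
    (hsupp : ∀ l ∈ Λ, ∀ i, l₀ i = 0 → l i = 0) (hη : 0 < η') (hu : IsDualStep Λ g l₀ η' u)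
    {l : Fin m → ℝ} (hl : l ∈ Λ) {τ : ℝ} (h0 : 0 < τ) (h1 : τ < 1) :
    kl l ((1 - τ) • u + τ • l) ≤ η' * (dualObjective g l₀ η' l - dualObjective g l₀ η' u) := by
  have hw : (1 - τ) • u + τ • l ∈ Λ := hconv hu.1 hl (by linarith) h0.le (by ring)
  have hmin : dualObjective g l₀ η' u ≤ dualObjective g l₀ η' ((1 - τ) • u + τ • l) := hu.2 hw
  have hk := kl_convexComb (hΛ hu.1).1 (hΛ hl).1 (hsupp u hu.1) (hsupp l hl) h0 h1
  have hlin : ∑ i, g i * ((1 - τ) • u + τ • l) i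
      = (1 - τ) * ∑ i, g i * u i + τ * ∑ i, g i * l i := by
    rw [mul_sum, mul_sum, ← sum_add_distrib]
    refine sum_congr rfl fun i _ => ?_
    simp only [Pi.add_apply, Pi.smul_apply, smul_eq_mul]; ring
  have hpos : 0 ≤ kl u ((1 - τ) • u + τ • l) := by
    refine kl_nonneg (hΛ hu.1) (hΛ hw) fun i hi => ?_
    simp only [Pi.add_apply, Pi.smul_apply, smul_eq_mul] at hi
    have := mul_nonneg h0.le ((hΛ hl).1 i)
    have := (hΛ hu.1).1 i
    nlinarith
  set w := (1 - τ) • u + τ • l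
  unfold dualObjective at hmin ⊢
  rw [hk, hlin] at hmin
  have hmin := mul_le_mul_of_nonneg_left hmin hη.le
  have e : ∀ a b : ℝ, η' * (a + b / η') = η' * a + b := fun a b => by field_simp
  rw [e, e] at hmin
  rw [mul_sub, e, e]
  have : τ * kl l w ≤ τ * (η' * ∑ i, g i * l i + kl l l₀ - (η' * ∑ i, g i * u i + kl u l₀)) := by
    nlinarith [mul_nonneg (by linarith : 0 ≤ 1 - τ) hpos]
  exact le_of_mul_le_mul_left this h0

/-- The divergence acts as a barrier: if `u i = 0 < l i`, the left side of `kl_segment_le` grows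
like `l i * log (1 / τ)` as `τ → 0`, while its right side does not depend on `τ`. -/
theorem IsDualStep.support (hΛ : Λ ⊆ stdSimplex ℝ (Fin m)) (hconv : Convex ℝ Λ)
    (hsupp : ∀ l ∈ Λ, ∀ i, l₀ i = 0 → l i = 0) (hη : 0 < η') (hu : IsDualStep Λ g l₀ η' u) :
    ∀ l ∈ Λ, ∀ i, u i = 0 → l i = 0 := by
  intro l hl i hi
  by_contra hne
  have hli : 0 < l i := ((hΛ hl).1 i).lt_of_ne (Ne.symm hne)
  set B := η' * (dualObjective g l₀ η' l - dualObjective g l₀ η' u)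
  have key : ∀ τ : ℝ, 0 < τ → τ < 1 → l i * Real.log (1 / τ) - 1 ≤ B := by
    intro τ h0 h1
    refine le_trans ?_ (hu.kl_segment_le hΛ hconv hsupp hη hl h0 h1)
    set w := (1 - τ) • u + τ • l with hwdef
    have hw : w ∈ Λ := hconv hu.1 hl (by linarith) h0.le (by ring)
    have hwi : w i = τ * l i := by simp [hwdef, hi]
    have hz : ∀ j, w j = 0 → l j = 0 := fun j hj => by
      simp only [hwdef, Pi.add_apply, Pi.smul_apply, smul_eq_mul] at hj
      have h2 := mul_nonneg (by linarith : 0 ≤ 1 - τ) ((hΛ hu.1).1 j)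
      have := (hΛ hl).1 j
      nlinarith
    -- Coordinates other than `i` contribute at least `l j - w j ≥ -w j`, and `w` has total mass
    -- `1`.
    have hle : ∀ j, (if j = i then l i * Real.log (1 / τ) else 0) - w j
        ≤ l j * Real.log (l j / w j) := by
      intro j
      split_ifs with hj
      · subst hj
        have : l j / (τ * l j) = 1 / τ := by field_simp
        rw [hwi, this]
        have := mul_pos h0 hli
        linarith
      · have h3 := le_mul_log_div ((hΛ hl).1 j) ((hΛ hw).1 j) (hz j)
        have h4 := (hΛ hl).1 j
        have h5 := (hΛ hw).1 j
        have : 0 ≤ 3 / 2 * ((l j - w j) ^ 2 / (l j + 2 * w j)) := by positivity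
        linarith
    have := sum_le_sum fun j (_ : j ∈ univ) => hle j
    rw [sum_sub_distrib, (hΛ hw).2] at this
    simpa [kl] using this
  have hpos : 0 < (|B| + 2) / l i := by positivity
  have := key (Real.exp (-((|B| + 2) / l i))) (Real.exp_pos _) (by
    rw [Real.exp_lt_one_iff]; linarith)
  rw [one_div, ← Real.exp_neg, neg_neg, Real.log_exp, mul_div_cancel₀ _ hli.ne'] at this
  linarith [le_abs_self B]

/-- The limit `τ → 0` in `kl_segment_le`; continuity at `0` rests on `support`. -/
theorem IsDualStep.three_point (hΛ : Λ ⊆ stdSimplex ℝ (Fin m)) (hconv : Convex ℝ Λ)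
    (hsupp : ∀ l ∈ Λ, ∀ i, l₀ i = 0 → l i = 0) (hη : 0 < η') (hu : IsDualStep Λ g l₀ η' u)
    {l : Fin m → ℝ} (hl : l ∈ Λ) :
    ∑ i, g i * (u i - l i) ≤ (kl l l₀ - kl l u - kl u l₀) / η' := by
  have hs := hu.support hΛ hconv hsupp hη l hl
  have hlim : Tendsto (fun τ : ℝ => kl l ((1 - τ) • u + τ • l)) (𝓝[>] 0) (𝓝 (kl l u)) := by
    have : ContinuousAt (fun τ : ℝ => kl l ((1 - τ) • u + τ • l)) 0 := by
      refine tendsto_finsetSum _ fun i _ => ?_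
      by_cases hi : l i = 0
      · simp [hi]
      · have hui : u i ≠ 0 := fun h => hi (hs i h)
        refine ContinuousAt.mul continuousAt_const (ContinuousAt.log
          (ContinuousAt.div continuousAt_const ?_ ?_) ?_)
        · simp only [Pi.add_apply, Pi.smul_apply, smul_eq_mul]
          fun_prop
        · simpa using hui
        · simp [hui, hi]
    have h := this.tendsto
    simp only [sub_zero, one_smul, zero_smul, add_zero] at h
    exact h.mono_left nhdsWithin_le_nhds
  have hle : kl l u ≤ η' * (dualObjective g l₀ η' l - dualObjective g l₀ η' u) := by
    refine le_of_tendsto hlim ?_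
    filter_upwards [Ioo_mem_nhdsGT (zero_lt_one (α := ℝ))] with τ hτ
    exact hu.kl_segment_le hΛ hconv hsupp hη hl hτ.1 hτ.2
  have e : ∀ a b : ℝ, η' * (a + b / η') = η' * a + b := fun a b => by field_simp
  rw [dualObjective, dualObjective, mul_sub, e, e] at hle
  rw [le_div_iff₀ hη]
  simp only [mul_sub, sum_sub_distrib]
  linarith

end

/-! ### The gradient inequality -/

theorem fderiv_eq_sum_grad {ι : Type*} [Fintype ι] (f : (ι → ℝ) → ℝ) (x y : ι → ℝ) :
    fderiv ℝ f x y = ∑ i, grad f x i * y i := by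
  classical
  conv_lhs => rw [pi_eq_sum_univ' y]
  rw [map_sum]
  refine sum_congr rfl fun i _ => ?_
  rw [map_smul, smul_eq_mul, mul_comm, grad]

/-- `D` need not be open: only one-sided difference quotients along the segment from `v` to `w` are
compared. -/
theorem concaveOn_sub_le_grad {ι : Type*} [Fintype ι] {f : (ι → ℝ) → ℝ} {D : Set (ι → ℝ)}
    (hf : ConcaveOn ℝ D f) {v w : ι → ℝ} (hv : v ∈ D) (hw : w ∈ D)
    (hd : DifferentiableAt ℝ f v) : f w - f v ≤ ∑ i, grad f v i * (w i - v i) := by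
  have h1 : HasDerivAt (fun τ : ℝ => f (v + τ • (w - v))) (fderiv ℝ f v (w - v)) 0 := by
    have hl : HasDerivAt (fun τ : ℝ => v + τ • (w - v)) (w - v) 0 := by
      simpa using ((hasDerivAt_id (0 : ℝ)).smul_const (w - v)).const_add v
    have hd' : HasFDerivAt f (fderiv ℝ f v) (v + (0 : ℝ) • (w - v)) := by
      simpa using hd.hasFDerivAt
    exact hd'.comp_hasDerivAt 0 hl
  have h2 := (hasDerivAt_iff_tendsto_slope.1 h1).mono_left
    (nhdsWithin_mono (0 : ℝ) (fun x hx => (ne_of_gt hx : x ≠ 0) : Set.Ioi (0 : ℝ) ⊆ {0}ᶜ))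
  have h3 : f w - f v ≤ fderiv ℝ f v (w - v) := by
    refine ge_of_tendsto h2 ?_
    filter_upwards [Ioo_mem_nhdsGT (zero_lt_one (α := ℝ))] with τ hτ
    have hc := hf.2 hv hw (by linarith [hτ.2] : 0 ≤ 1 - τ) hτ.1.le (by ring)
    have he : (1 - τ) • v + τ • w = v + τ • (w - v) := by
      ext i; simp; ring
    rw [he] at hc
    simp only [smul_eq_mul] at hc
    rw [slope_def_field, le_div_iff₀ (by linarith [hτ.1])]
    simp only [zero_smul, add_zero, sub_zero]
    linarith
  rw [fderiv_eq_sum_grad] at h3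
  simpa using h3

theorem grad_neg {ι : Type*} [Fintype ι] (f : (ι → ℝ) → ℝ) (x : ι → ℝ) :
    grad (fun y => -f y) x = -grad f x := by
  ext i; simp [grad]

theorem convexOn_grad_le_sub {ι : Type*} [Fintype ι] {f : (ι → ℝ) → ℝ} {D : Set (ι → ℝ)}
    (hf : ConvexOn ℝ D f) {v w : ι → ℝ} (hv : v ∈ D) (hw : w ∈ D)
    (hd : DifferentiableAt ℝ f v) : f v - f w ≤ ∑ i, grad f v i * (v i - w i) := by
  have := concaveOn_sub_le_grad (f := fun y => -f y) hf.neg hv hw hd.neg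
  rw [grad_neg] at this
  simp only [Pi.neg_apply, neg_mul, sum_neg_distrib] at this
  have e : ∑ i, grad f v i * (v i - w i) = -∑ i, grad f v i * (w i - v i) := by
    rw [← sum_neg_distrib]; exact sum_congr rfl fun i _ => by ring
  linarith

/-! ### Softmax policies -/

theorem softmax_pos {S A : Type*} [Fintype A] (θ : S × A → ℝ) (s : S) (a : A) :
    0 < softmax θ s a :=
  div_pos (Real.exp_pos _) (sum_pos (fun _ _ => Real.exp_pos _) ⟨a, mem_univ a⟩)

theorem isPolicy_softmax {S A : Type*} [Fintype A] [Nonempty A] (θ : S × A → ℝ) :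
    IsPolicy (softmax θ) := fun s => by
  refine ⟨fun a => (softmax_pos θ s a).le, ?_⟩
  have h : 0 < ∑ a, Real.exp (θ (s, a)) := sum_pos (fun _ _ => Real.exp_pos _) univ_nonempty
  simp only [softmax]
  rw [← sum_div, div_self h.ne']

theorem IsPolicy.avg_le {S A : Type*} [Fintype A] {π : S → A → ℝ}
    (hπ : IsPolicy π) (s : S) {f : A → ℝ} {B : ℝ}
    (h : ∀ a, f a ≤ B) : ∑ a, π s a * f a ≤ B := by
  calc ∑ a, π s a * f a ≤ ∑ a, π s a * B :=
        sum_le_sum fun a _ => mul_le_mul_of_nonneg_left (h a) ((hπ s).1 a)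
    _ = B := by rw [← sum_mul, (hπ s).2, one_mul]

namespace MOMDP

variable {S A : Type*} [Fintype S] [Fintype A] {m : ℕ} (M : MOMDP S A m)

/-! ### Visitation distributions -/

theorem stateProb_nonneg {π : S → A → ℝ} (hπ : IsPolicy π) (t : ℕ) (s : S) :
    0 ≤ M.stateProb π t s := by
  induction t generalizing s with
  | zero => exact M.ρ_mem.1 s
  | succ t ih =>
    exact sum_nonneg fun s' _ => sum_nonneg fun a _ =>
      mul_nonneg (mul_nonneg (ih s') ((hπ s').1 a)) ((M.P_mem s' a).1 s)

theorem sum_stateProb {π : S → A → ℝ} (hπ : IsPolicy π) (t : ℕ) :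
    ∑ s, M.stateProb π t s = 1 := by
  induction t with
  | zero => exact M.ρ_mem.2
  | succ t ih =>
    simp only [stateProb]
    rw [sum_comm]
    calc ∑ s, ∑ s', ∑ a, M.stateProb π t s * π s a * M.P s a s'
        = ∑ s, M.stateProb π t s := sum_congr rfl fun s _ => by
          rw [sum_comm]
          simp only [← mul_sum, (M.P_mem s _).2, mul_one, (hπ s).2]
      _ = 1 := ih

theorem stateProb_le_one {π : S → A → ℝ} (hπ : IsPolicy π) (t : ℕ) (s : S) :
    M.stateProb π t s ≤ 1 := by
  rw [← M.sum_stateProb hπ t]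
  exact single_le_sum (fun s _ => M.stateProb_nonneg hπ t s) (mem_univ s)

theorem summable_stateProb {π : S → A → ℝ} (hπ : IsPolicy π) (s : S) :
    Summable fun t : ℕ => M.γ ^ t * M.stateProb π t s := by
  refine Summable.of_nonneg_of_le
    (fun t => mul_nonneg (pow_nonneg M.γ_pos.le t) (M.stateProb_nonneg hπ t s)) (fun t => ?_)
    (summable_geometric_of_lt_one M.γ_pos.le M.γ_lt_one)
  exact mul_le_of_le_one_right (pow_nonneg M.γ_pos.le t) (M.stateProb_le_one hπ t s)

theorem one_sub_γ_pos : 0 < 1 - M.γ := sub_pos.2 M.γ_lt_one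

theorem sVisit_nonneg {π : S → A → ℝ} (hπ : IsPolicy π) (s : S) : 0 ≤ M.sVisit π s :=
  mul_nonneg M.one_sub_γ_pos.le <| tsum_nonneg fun t =>
    mul_nonneg (pow_nonneg M.γ_pos.le t) (M.stateProb_nonneg hπ t s)

theorem hasSum_stateProb {π : S → A → ℝ} (hπ : IsPolicy π) (s : S) :
    HasSum (fun t : ℕ => M.γ ^ t * M.stateProb π t s) (M.sVisit π s / (1 - M.γ)) := by
  rw [sVisit, mul_div_cancel_left₀ _ M.one_sub_γ_pos.ne']
  exact (M.summable_stateProb hπ s).hasSum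

theorem sum_sVisit {π : S → A → ℝ} (hπ : IsPolicy π) : ∑ s, M.sVisit π s = 1 := by
  have h1 := hasSum_sum fun s (_ : s ∈ univ) => M.hasSum_stateProb hπ s
  simp only [← mul_sum, M.sum_stateProb hπ, mul_one, ← sum_div] at h1
  have h2 := h1.unique (hasSum_geometric_of_lt_one M.γ_pos.le M.γ_lt_one)
  rw [div_eq_iff M.one_sub_γ_pos.ne', inv_mul_cancel₀ M.one_sub_γ_pos.ne'] at h2
  exact h2

theorem saVisit_eq (π : S → A → ℝ) (s : S) (a : A) :
    M.saVisit π s a = M.sVisit π s * π s a := by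
  simp only [saVisit, sVisit, ← mul_assoc]
  rw [tsum_mul_right]
  ring

theorem value_eq {π : S → A → ℝ} (hπ : IsPolicy π) (r : S → A → ℝ) :
    (1 - M.γ) * M.value π r = ∑ s, M.sVisit π s * ∑ a, π s a * r s a := by
  have h := hasSum_sum fun s (_ : s ∈ univ) =>
    (M.hasSum_stateProb hπ s).mul_right (∑ a, π s a * r s a)
  have e : M.value π r = ∑ s, M.sVisit π s / (1 - M.γ) * ∑ a, π s a * r s a := by
    rw [← h.tsum_eq, value]
    refine tsum_congr fun t => ?_
    rw [mul_sum]
    refine sum_congr rfl fun s _ => ?_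
    rw [mul_sum, mul_sum]
    exact sum_congr rfl fun a _ => by ring
  rw [e, mul_sum]
  refine sum_congr rfl fun s _ => ?_
  rw [← mul_assoc, mul_div_cancel₀ _ M.one_sub_γ_pos.ne']

/-- The expectation of `f` at the successor of the state-action pair `(s, a)`. -/
def next (f : S → ℝ) (s : S) (a : A) : ℝ := ∑ s', M.P s a s' * f s'

theorem next_sub (f g : S → ℝ) (s : S) (a : A) :
    M.next (fun x => f x - g x) s a = M.next f s a - M.next g s a := by
  simp only [next, mul_sub, sum_sub_distrib]

/-- Obtained by splitting off time `0` from the discounted series. -/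
theorem sVisit_flow {π : S → A → ℝ} (hπ : IsPolicy π) (s' : S) :
    M.sVisit π s' = (1 - M.γ) * M.ρ s'
      + M.γ * ∑ s, M.sVisit π s * ∑ a, π s a * M.P s a s' := by
  have h := (hasSum_sum fun s (_ : s ∈ univ) =>
    (M.hasSum_stateProb hπ s).mul_right (∑ a, π s a * M.P s a s')).mul_left M.γ
  have h1 := (M.summable_stateProb hπ s').tsum_eq_zero_add
  have h2 : ∑' t : ℕ, M.γ ^ (t + 1) * M.stateProb π (t + 1) s'
      = M.γ * ∑ s, M.sVisit π s / (1 - M.γ) * ∑ a, π s a * M.P s a s' := by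
    rw [← h.tsum_eq]
    refine tsum_congr fun t => ?_
    rw [pow_succ, stateProb, mul_sum, mul_sum]
    refine sum_congr rfl fun s _ => ?_
    rw [mul_sum, mul_sum, mul_sum]
    exact sum_congr rfl fun a _ => by ring
  rw [h2] at h1
  have h3 : M.sVisit π s' = (1 - M.γ) * ∑' t : ℕ, M.γ ^ t * M.stateProb π t s' := rfl
  rw [h3, h1, pow_zero, one_mul, stateProb, mul_add, mul_left_comm, mul_sum (a := 1 - M.γ)]
  congr 2
  refine sum_congr rfl fun s _ => ?_
  rw [← mul_assoc, mul_div_cancel₀ _ M.one_sub_γ_pos.ne']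

theorem sum_sVisit_mul {π : S → A → ℝ} (hπ : IsPolicy π) (f : S → ℝ) :
    ∑ s, M.sVisit π s * f s = (1 - M.γ) * ∑ s, M.ρ s * f s
      + M.γ * ∑ s, M.sVisit π s * ∑ a, π s a * M.next f s a := by
  have h : ∑ s, M.sVisit π s * ∑ a, π s a * M.next f s a
      = ∑ s', (∑ s, M.sVisit π s * ∑ a, π s a * M.P s a s') * f s' := by
    simp only [next, mul_sum, sum_mul]
    rw [sum_comm' (t' := univ) (s' := fun _ => univ) (by simp)]
    rw [sum_comm]
    conv_rhs => rw [sum_comm]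
    refine sum_congr rfl fun s _ => ?_
    conv_rhs => rw [sum_comm]
    refine sum_congr rfl fun a _ => sum_congr rfl fun s' _ => ?_
    ring
  rw [h, mul_sum, mul_sum, ← sum_add_distrib]
  refine sum_congr rfl fun s _ => ?_
  conv_lhs => rw [M.sVisit_flow hπ s]
  ring

/-- The performance difference identity, with an arbitrary baseline `f`. -/
theorem value_sub {π : S → A → ℝ} (hπ : IsPolicy π) (r : S → A → ℝ) (f : S → ℝ) :
    (1 - M.γ) * (M.value π r - ∑ s, M.ρ s * f s)
      = ∑ s, M.sVisit π s * (∑ a, π s a * (r s a + M.γ * M.next f s a) - f s) := by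
  have h := M.sum_sVisit_mul hπ f
  have e : ∀ s, M.sVisit π s * (∑ a, π s a * (r s a + M.γ * M.next f s a) - f s)
      = M.sVisit π s * ∑ a, π s a * r s a
        + M.γ * (M.sVisit π s * ∑ a, π s a * M.next f s a) - M.sVisit π s * f s := by
    intro s
    have : ∑ a, π s a * (r s a + M.γ * M.next f s a)
        = ∑ a, π s a * r s a + M.γ * ∑ a, π s a * M.next f s a := by
      rw [mul_sum, ← sum_add_distrib]
      exact sum_congr rfl fun a _ => by ring
    rw [this]; ring
  simp only [e, sum_sub_distrib, sum_add_distrib, ← mul_sum]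
  rw [mul_sub, M.value_eq hπ r]
  linarith

/-! ### Reachable states -/

/-- The states that are visited with positive probability under full-support policies. -/
inductive Reach : S → Prop
  | init {s : S} : M.ρ s ≠ 0 → Reach s
  | step {s : S} {a : A} {s' : S} : Reach s → M.P s a s' ≠ 0 → Reach s'

theorem stateProb_eq_zero {π : S → A → ℝ} (t : ℕ) {s : S} (hs : ¬ M.Reach s) :
    M.stateProb π t s = 0 := by
  induction t generalizing s with
  | zero => by_contra h; exact hs (.init h)
  | succ t ih =>
    refine sum_eq_zero fun s' _ => sum_eq_zero fun a _ => ?_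
    by_cases h : M.Reach s'
    · by_cases h' : M.P s' a s = 0
      · simp [h']
      · exact absurd (.step h h') hs
    · simp [ih h]

theorem sVisit_eq_zero {π : S → A → ℝ} {s : S} (hs : ¬ M.Reach s) : M.sVisit π s = 0 := by
  simp [sVisit, M.stateProb_eq_zero _ hs]

theorem sVisit_pos {π : S → A → ℝ} (hπ : IsPolicy π) (hp : ∀ s a, 0 < π s a) {s : S}
    (hs : M.Reach s) : 0 < M.sVisit π s := by
  have hn : ∀ s s' : S, ∀ a, 0 ≤ π s a * M.P s a s' := fun s s' a =>
    mul_nonneg ((hπ s).1 a) ((M.P_mem s a).1 s')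
  have hnn : ∀ s', ∀ s ∈ univ, 0 ≤ M.sVisit π s * ∑ a, π s a * M.P s a s' := fun s' s _ =>
    mul_nonneg (M.sVisit_nonneg hπ s) (sum_nonneg fun a _ => hn s s' a)
  induction hs with
  | @init s h =>
    rw [M.sVisit_flow hπ]
    have h1 := mul_pos M.one_sub_γ_pos ((M.ρ_mem.1 s).lt_of_ne h.symm)
    have h2 := mul_nonneg M.γ_pos.le (sum_nonneg (hnn s))
    linarith
  | @step s a s' _ h ih =>
    rw [M.sVisit_flow hπ]
    have h1 := mul_nonneg M.one_sub_γ_pos.le (M.ρ_mem.1 s')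
    have h2 : 0 < ∑ s, M.sVisit π s * ∑ a, π s a * M.P s a s' := by
      refine sum_pos' (hnn s') ⟨s, mem_univ s, mul_pos ih ?_⟩
      exact sum_pos' (fun a _ => hn s s' a)
        ⟨a, mem_univ a, mul_pos (hp s a) (((M.P_mem s a).1 s').lt_of_ne h.symm)⟩
    have := mul_pos M.γ_pos h2
    linarith

/-- Unreachable states carry no mass, so estimates are needed only where the Fisher matrix controls
the update. -/
theorem sum_sVisit_le {π : S → A → ℝ} (hπ : IsPolicy π) {f g : S → ℝ}
    (h : ∀ s, M.Reach s → f s ≤ g s) :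
    ∑ s, M.sVisit π s * f s ≤ ∑ s, M.sVisit π s * g s :=
  sum_le_sum fun s _ => by
    by_cases hs : M.Reach s
    · exact mul_le_mul_of_nonneg_left (h s hs) (M.sVisit_nonneg hπ s)
    · simp [M.sVisit_eq_zero hs]

theorem sum_sVisit_congr {π : S → A → ℝ} {f g : S → ℝ} (h : ∀ s, M.Reach s → f s = g s) :
    ∑ s, M.sVisit π s * f s = ∑ s, M.sVisit π s * g s :=
  sum_congr rfl fun s _ => by
    by_cases hs : M.Reach s
    · rw [h s hs]
    · simp [M.sVisit_eq_zero hs]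

/-! ### Bellman equations -/

theorem next_le {f : S → ℝ} {B : ℝ} (h : ∀ s, M.Reach s → f s ≤ B) {s : S} (hs : M.Reach s)
    (a : A) : M.next f s a ≤ B := by
  calc M.next f s a ≤ ∑ s', M.P s a s' * B := sum_le_sum fun s' _ => by
        by_cases h0 : M.P s a s' = 0
        · simp [h0]
        · exact mul_le_mul_of_nonneg_left (h s' (.step hs h0)) ((M.P_mem s a).1 s')
    _ = B := by rw [← sum_mul, (M.P_mem s a).2, one_mul]

theorem next_mono {f g : S → ℝ} (h : ∀ s, M.Reach s → f s ≤ g s) {s : S} (hs : M.Reach s)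
    (a : A) : M.next f s a ≤ M.next g s a := by
  have := M.next_le (f := fun s => f s - g s) (B := 0) (fun s hs => sub_nonpos.2 (h s hs)) hs a
  rw [next_sub] at this
  linarith

/-- A maximum principle on the reachable states. -/
theorem le_of_le_bellman {π : S → A → ℝ} (hπ : IsPolicy π) {u : S → ℝ} {b : ℝ}
    (h : ∀ s, M.Reach s → u s ≤ b + M.γ * ∑ a, π s a * M.next u s a) {s : S} (hs : M.Reach s) :
    u s ≤ b / (1 - M.γ) := by
  classical
  obtain ⟨s₀, h₀, hmax⟩ := exists_max_image (univ.filter M.Reach) u ⟨s, by simpa using hs⟩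
  simp only [mem_filter, mem_univ, true_and] at h₀ hmax
  have h1 : ∑ a, π s₀ a * M.next u s₀ a ≤ u s₀ :=
    hπ.avg_le s₀ fun a => M.next_le hmax h₀ a
  have h2 := h s₀ h₀
  have h3 := mul_le_mul_of_nonneg_left h1 M.γ_pos.le
  refine (hmax s hs).trans ?_
  rw [le_div_iff₀ M.one_sub_γ_pos]
  linarith

/-- `I - γ P^π` is injective, because a kernel vector is a fixed point of a `γ`-contraction in the
sup norm; in finite dimension it is then surjective. -/
theorem exists_bellman [Nonempty A] {π : S → A → ℝ} (hπ : IsPolicy π) (c : S → ℝ) :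
    ∃ V : S → ℝ, ∀ s, V s = c s + M.γ * ∑ a, π s a * M.next V s a := by
  classical
  let T : (S → ℝ) →ₗ[ℝ] (S → ℝ) :=
    { toFun := fun V s => V s - M.γ * ∑ a, π s a * M.next V s a
      map_add' := fun V W => by
        ext s
        simp only [next, Pi.add_apply, mul_add, sum_add_distrib]
        ring
      map_smul' := fun k V => by
        ext s
        simp only [next, Pi.smul_apply, smul_eq_mul, RingHom.id_apply, mul_sub, mul_sum]
        congr 1
        exact sum_congr rfl fun a _ => sum_congr rfl fun s' _ => by ring }
  have hinj : Function.Injective T := by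
    rw [← LinearMap.ker_eq_bot, LinearMap.ker_eq_bot']
    intro V hV
    have hV' : ∀ s, V s = M.γ * ∑ a, π s a * M.next V s a := fun s =>
      sub_eq_zero.1 (congrFun hV s)
    have hn : ‖V‖ ≤ M.γ * ‖V‖ := by
      refine (pi_norm_le_iff_of_nonneg (mul_nonneg M.γ_pos.le (norm_nonneg V))).2 fun s => ?_
      rw [hV' s, norm_mul, Real.norm_of_nonneg M.γ_pos.le]
      refine mul_le_mul_of_nonneg_left ?_ M.γ_pos.le
      refine (norm_sum_le _ _).trans ?_
      refine le_trans (sum_le_sum fun a _ => ?_)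
        (hπ.avg_le s (f := fun _ => ‖V‖) fun _ => le_rfl)
      rw [norm_mul, Real.norm_of_nonneg ((hπ s).1 a)]
      refine mul_le_mul_of_nonneg_left ?_ ((hπ s).1 a)
      refine (norm_sum_le _ _).trans ?_
      calc ∑ s', ‖M.P s a s' * V s'‖ ≤ ∑ s', M.P s a s' * ‖V‖ := sum_le_sum fun s' _ => by
            rw [norm_mul, Real.norm_of_nonneg ((M.P_mem s a).1 s')]
            exact mul_le_mul_of_nonneg_left (norm_le_pi_norm V s') ((M.P_mem s a).1 s')
        _ = ‖V‖ := by rw [← sum_mul, (M.P_mem s a).2, one_mul]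
    have : ‖V‖ = 0 := by nlinarith [norm_nonneg V, M.one_sub_γ_pos]
    exact norm_eq_zero.1 this
  obtain ⟨V, hV⟩ := LinearMap.surjective_of_injective hinj c
  refine ⟨V, fun s => ?_⟩
  have := congrFun hV s
  change V s - M.γ * ∑ a, π s a * M.next V s a = c s at this
  linarith

/-! ### Divergences between policies -/

theorem policyKL_nonneg {π π' : S → A → ℝ} (hπ : IsPolicy π) (hπ' : IsPolicy π')
    (hp : ∀ s a, 0 < π' s a) : 0 ≤ M.policyKL π π' :=
  sum_nonneg fun s _ => mul_nonneg (M.sVisit_nonneg hπ s)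
    (kl_nonneg (hπ s) (hπ' s) fun a h => absurd h (hp s a).ne')

theorem policyKL_self (π : S → A → ℝ) : M.policyKL π π = 0 :=
  sum_eq_zero fun s _ => by rw [kl_self, mul_zero]

theorem policyKL_uniform_le {π π' : S → A → ℝ} (hπ : IsPolicy π)
    (h : ∀ s a, π' s a = 1 / (Fintype.card A : ℝ)) :
    M.policyKL π π' ≤ Real.log (Fintype.card A) := by
  calc M.policyKL π π' ≤ ∑ s, M.sVisit π s * Real.log (Fintype.card A) :=
        sum_le_sum fun s _ => mul_le_mul_of_nonneg_left (kl_uniform_le (hπ s) (h s))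
          (M.sVisit_nonneg hπ s)
    _ = _ := by rw [← sum_mul, M.sum_sVisit hπ, one_mul]

/-- Performance difference with the value function of `π'` as baseline. Its action values are at
most `1 / (1 - γ)` in size, so the difference is bounded by the mean `ℓ¹` distance of the policies
over `(1 - γ) ^ 2`; Jensen and Pinsker conclude. -/
theorem value_sub_sq_le [Nonempty A] {π π' : S → A → ℝ} (hπ : IsPolicy π) (hπ' : IsPolicy π')
    (hp : ∀ s a, 0 < π' s a) {r : S → A → ℝ} (hr : ∀ s a, r s a ∈ Set.Icc (0 : ℝ) 1) :
    (M.value π r - M.value π' r) ^ 2 ≤ 2 * M.policyKL π π' / (1 - M.γ) ^ 4 := by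
  have hγ := M.one_sub_γ_pos
  obtain ⟨V, hV⟩ := M.exists_bellman hπ' fun s => ∑ a, π' s a * r s a
  set Q : S → A → ℝ := fun s a => r s a + M.γ * M.next V s a with hQdef
  have hVQ : ∀ s, V s = ∑ a, π' s a * Q s a := fun s => by
    rw [hV s, mul_sum, ← sum_add_distrib]
    exact sum_congr rfl fun a _ => by simp only [hQdef]; ring
  have hρ : M.value π' r = ∑ s, M.ρ s * V s := by
    have h := M.value_sub hπ' r V
    have hz : ∑ s, M.sVisit π' s * (∑ a, π' s a * (r s a + M.γ * M.next V s a) - V s) = 0 :=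
      sum_eq_zero fun s _ => by
        rw [show ∑ a, π' s a * (r s a + M.γ * M.next V s a) = V s from (hVQ s).symm, sub_self,
          mul_zero]
    rcases mul_eq_zero.1 (h.trans hz) with h | h
    · exact absurd h hγ.ne'
    · linarith
  have hV1 : ∀ s, M.Reach s → V s ≤ 1 / (1 - M.γ) := fun s hs =>
    M.le_of_le_bellman hπ' (fun s _ => by
      rw [hV s]; exact add_le_add_left (hπ'.avg_le s fun a => (hr s a).2) _) hs
  have hV0 : ∀ s, M.Reach s → 0 ≤ V s := fun s hs => by
    have := M.le_of_le_bellman (u := fun s => 0 - V s) (b := 0) hπ' (fun s _ => by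
      simp only [next_sub]
      have h1 : 0 ≤ ∑ a, π' s a * r s a :=
        sum_nonneg fun a _ => mul_nonneg ((hπ' s).1 a) (hr s a).1
      rw [hV s]
      have h0 : ∀ a, M.next (fun _ => (0 : ℝ)) s a = 0 := fun a => by simp [next]
      simp only [h0, zero_sub, mul_neg, sum_neg_distrib]
      linarith) hs
    simpa using this
  have hQ : ∀ s, M.Reach s → ∀ a, |Q s a| ≤ 1 / (1 - M.γ) := by
    intro s hs a
    have h1 := M.next_le hV1 hs a
    have h0 : 0 ≤ M.next V s a := by
      have := M.next_mono (f := fun _ => 0) hV0 hs a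
      simpa [next] using this
    rw [abs_of_nonneg (add_nonneg (hr s a).1 (mul_nonneg M.γ_pos.le h0))]
    have h2 := mul_le_mul_of_nonneg_left h1 M.γ_pos.le
    have h3 : 1 / (1 - M.γ) = 1 + M.γ * (1 / (1 - M.γ)) := by field_simp; ring
    rw [h3]
    exact add_le_add (hr s a).2 h2
  have hdiff : (1 - M.γ) * (M.value π r - M.value π' r)
      = ∑ s, M.sVisit π s * ∑ a, (π s a - π' s a) * Q s a := by
    rw [hρ, M.value_sub hπ r V]
    refine sum_congr rfl fun s _ => ?_
    rw [hVQ s, ← sum_sub_distrib]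
    congr 1
    exact sum_congr rfl fun a _ => by simp only [hQdef]; ring
  have habs : (1 - M.γ) * |M.value π r - M.value π' r|
      ≤ (∑ s, M.sVisit π s * l1 (π s - π' s)) * (1 / (1 - M.γ)) := by
    rw [← abs_of_pos hγ, ← abs_mul, hdiff, abs_of_pos hγ]
    refine (abs_sum_le_sum_abs _ _).trans ?_
    have habs : ∀ s, |M.sVisit π s * ∑ a, (π s a - π' s a) * Q s a|
        = M.sVisit π s * |∑ a, (π s a - π' s a) * Q s a| := fun s => by
      rw [abs_mul, abs_of_nonneg (M.sVisit_nonneg hπ s)]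
    simp only [habs]
    rw [sum_mul]
    simp only [mul_assoc]
    refine M.sum_sVisit_le hπ fun s hs => (abs_sum_le_sum_abs _ _).trans ?_
    rw [l1, sum_mul]
    refine sum_le_sum fun a _ => ?_
    rw [abs_mul]
    exact mul_le_mul_of_nonneg_left (hQ s hs a) (abs_nonneg _)
  have hjensen : (∑ s, M.sVisit π s * l1 (π s - π' s)) ^ 2 ≤ 2 * M.policyKL π π' := by
    have h1 : (∑ s, M.sVisit π s * l1 (π s - π' s)) ^ 2
        ≤ (∑ s, M.sVisit π s) * ∑ s, M.sVisit π s * l1 (π s - π' s) ^ 2 := by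
      refine sum_sq_le_sum_mul_sum_of_sq_le_mul _ (fun s _ => M.sVisit_nonneg hπ s)
        (fun s _ => mul_nonneg (M.sVisit_nonneg hπ s) (sq_nonneg _)) fun s _ => ?_
      exact le_of_eq (by ring)
    rw [M.sum_sVisit hπ, one_mul] at h1
    refine h1.trans ?_
    rw [policyKL, mul_sum]
    refine sum_le_sum fun s _ => ?_
    have := mul_le_mul_of_nonneg_left
      (l1_sq_le_two_mul_kl (hπ s) (hπ' s) fun a h => absurd h (hp s a).ne')
      (M.sVisit_nonneg hπ s)
    linarith
  rw [le_div_iff₀ (by positivity)]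
  have h1 : (1 - M.γ) ^ 2 * |M.value π r - M.value π' r|
      ≤ ∑ s, M.sVisit π s * l1 (π s - π' s) := by
    have := mul_le_mul_of_nonneg_left habs hγ.le
    rw [mul_comm (∑ s, _) _, ← mul_assoc (1 - M.γ) (1 / (1 - M.γ)), mul_one_div_cancel hγ.ne',
      one_mul] at this
    linarith
  have h2 := pow_le_pow_left₀ (by positivity) h1 2
  rw [mul_pow, sq_abs] at h2
  nlinarith

end MOMDP

/-! ### Score functions and differentiability of softmax policies -/

theorem grad_eq_of_hasFDerivAt {ι : Type*} [Fintype ι] [DecidableEq ι] {f : (ι → ℝ) → ℝ}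
    {f' : (ι → ℝ) →L[ℝ] ℝ} {x : ι → ℝ} (h : HasFDerivAt f f' x) (i : ι) :
    grad f x i = f' (Pi.single i 1) := by
  rw [grad, h.fderiv]
  congr!

section Score
variable {S A : Type*} [Fintype A]

/-- The derivative of `log π_θ(a|s)` with respect to `θ`. -/
noncomputable def score (θ : S × A → ℝ) (s : S) (a : A) : (S × A → ℝ) →L[ℝ] ℝ :=
  ContinuousLinearMap.proj (s, a)
    - ∑ b, softmax θ s b • (ContinuousLinearMap.proj (s, b) : (S × A → ℝ) →L[ℝ] ℝ)

theorem score_apply (θ x : S × A → ℝ) (s : S) (a : A) :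
    score θ s a x = x (s, a) - ∑ b, softmax θ s b * x (s, b) := by
  simp [score]

theorem log_softmax [Nonempty A] (θ : S × A → ℝ) (s : S) (a : A) :
    Real.log (softmax θ s a) = θ (s, a) - Real.log (∑ b, Real.exp (θ (s, b))) := by
  have h : 0 < ∑ b, Real.exp (θ (s, b)) := sum_pos (fun _ _ => Real.exp_pos _) univ_nonempty
  rw [softmax, Real.log_div (Real.exp_pos _).ne' h.ne', Real.log_exp]

theorem sum_softmax_smul_score [Nonempty A] (θ : S × A → ℝ) (s : S) :
    ∑ a, softmax θ s a • score θ s a = 0 := by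
  ext x
  simp only [_root_.sum_apply, _root_.smul_apply, score_apply, smul_eq_mul, mul_sub,
    sum_sub_distrib, ← sum_mul, (isPolicy_softmax θ s).2]
  simp

variable [Fintype S]

theorem hasFDerivAt_log_softmax [Nonempty A] (θ : S × A → ℝ) (s : S) (a : A) :
    HasFDerivAt (fun θ' => Real.log (softmax θ' s a)) (score θ s a) θ := by
  have h : 0 < ∑ b, Real.exp (θ (s, b)) := sum_pos (fun _ _ => Real.exp_pos _) univ_nonempty
  have hp : ∀ b, HasFDerivAt (fun θ' : S × A → ℝ => θ' (s, b))
      (ContinuousLinearMap.proj (s, b) : (S × A → ℝ) →L[ℝ] ℝ) θ := fun b =>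
    (ContinuousLinearMap.proj (s, b) : (S × A → ℝ) →L[ℝ] ℝ).hasFDerivAt
  simp only [log_softmax]
  refine ((hp a).sub ((HasFDerivAt.fun_sum fun b _ => (hp b).exp).log h.ne')).congr_fderiv ?_
  rw [score, smul_sum]
  congr 1
  refine sum_congr rfl fun b _ => ?_
  rw [smul_smul, softmax, div_eq_inv_mul]

theorem hasFDerivAt_softmax [Nonempty A] (θ : S × A → ℝ) (s : S) (a : A) :
    HasFDerivAt (fun θ' => softmax θ' s a) (softmax θ s a • score θ s a) θ := by
  have := (hasFDerivAt_log_softmax θ s a).exp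
  simpa only [Real.exp_log (softmax_pos _ s a)] using this

theorem continuous_softmax [Nonempty A] (s : S) (a : A) :
    Continuous fun θ : S × A → ℝ => softmax θ s a :=
  continuous_iff_continuousAt.2 fun θ => (hasFDerivAt_softmax θ s a).continuousAt

end Score

/-- Since `g` vanishes at `x`, the variation of `d` is of higher order. This spares differentiating
the visitation distribution. -/
theorem hasFDerivAt_mul_of_continuousAt {E : Type*} [NormedAddCommGroup E] [NormedSpace ℝ E]
    {d g : E → ℝ} {g' : E →L[ℝ] ℝ} {x : E} (hd : ContinuousAt d x) (hg : HasFDerivAt g g' x)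
    (h0 : g x = 0) : HasFDerivAt (fun y => d y * g y) (d x • g') x := by
  have h1 : (fun y => (d y - d x) * g y) =o[𝓝 x] fun y => y - x := by
    have ha : (fun y => d y - d x) =o[𝓝 x] fun _ => (1 : ℝ) := by
      rw [Asymptotics.isLittleO_one_iff]
      simpa using hd.tendsto.sub_const (d x)
    have hb : g =O[𝓝 x] fun y => y - x := by simpa [h0] using hg.isBigO_sub
    have := ha.mul_isBigO hb.norm_right
    simpa using this
  have h2 : HasFDerivAt (fun y => (d y - d x) * g y) (0 : E →L[ℝ] ℝ) x :=
    HasFDerivAt.of_isLittleO (by simpa [h0] using h1)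
  have h3 := h2.add (hg.const_mul (d x))
  refine (h3.congr_fderiv (by simp)).congr_of_eventuallyEq (Eventually.of_forall fun y => ?_)
  simp only [Pi.add_apply]
  ring

/-! ### The natural policy gradient step -/

theorem mulVec_pinv_mulVec_sub {n : Type*} [Fintype n] (F : Matrix n n ℝ) (w : n → ℝ) :
    F *ᵥ (pinv F *ᵥ (F *ᵥ w) - w) = 0 := by
  have h : IsMoorePenrose F (pinv F) := (exists_isMoorePenrose F).choose_spec
  rw [Matrix.mulVec_sub, Matrix.mulVec_mulVec, Matrix.mulVec_mulVec, h.mul_mul_self, sub_self]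

namespace MOMDP
variable {S A : Type*} [Fintype S] [Fintype A] {m : ℕ} (M : MOMDP S A m)

theorem continuous_stateProb [Nonempty A] (t : ℕ) (s : S) :
    Continuous fun θ : S × A → ℝ => M.stateProb (softmax θ) t s := by
  induction t generalizing s with
  | zero => exact continuous_const
  | succ t ih =>
    exact continuous_finsetSum _ fun s' _ => continuous_finsetSum _ fun a _ =>
      ((ih s').mul (continuous_softmax s' a)).mul continuous_const

theorem continuous_sVisit [Nonempty A] (s : S) :
    Continuous fun θ : S × A → ℝ => M.sVisit (softmax θ) s := by
  refine continuous_const.mul (continuous_tsum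
    (fun t => continuous_const.mul (M.continuous_stateProb t s))
    (summable_geometric_of_lt_one M.γ_pos.le M.γ_lt_one) fun t θ => ?_)
  rw [Real.norm_of_nonneg (mul_nonneg (pow_nonneg M.γ_pos.le t)
    (M.stateProb_nonneg (isPolicy_softmax θ) t s))]
  exact mul_le_of_le_one_right (pow_nonneg M.γ_pos.le t)
    (M.stateProb_le_one (isPolicy_softmax θ) t s)

/-- The action values `r + γ P V` induced by state values `V`. -/
noncomputable def qval (r : S → A → ℝ) (V : S → ℝ) (s : S) (a : A) : ℝ :=
  r s a + M.γ * M.next V s a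

/-- `V` is the value function of `π` for the reward `r` regularized by `-α D(π‖π₀)`. -/
def IsRegValue (r : S → A → ℝ) (α : ℝ) (π₀ π : S → A → ℝ) (V : S → ℝ) : Prop :=
  ∀ s, V s = ∑ a, π s a * M.qval r V s a - α * kl (π s) (π₀ s)

theorem exists_isRegValue [Nonempty A] (r : S → A → ℝ) (α : ℝ) (π₀ : S → A → ℝ) {π : S → A → ℝ}
    (hπ : IsPolicy π) : ∃ V, M.IsRegValue r α π₀ π V := by
  obtain ⟨V, hV⟩ := M.exists_bellman hπ fun s => ∑ a, π s a * r s a - α * kl (π s) (π₀ s)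
  refine ⟨V, fun s => ?_⟩
  have : ∑ a, π s a * M.qval r V s a
      = ∑ a, π s a * r s a + M.γ * ∑ a, π s a * M.next V s a := by
    rw [mul_sum, ← sum_add_distrib]
    exact sum_congr rfl fun a _ => by rw [qval]; ring
  rw [this]
  linarith [hV s]

theorem regValue_sub [Nonempty A] (r : S → A → ℝ) (α : ℝ) (θ₀ θ : S × A → ℝ) (V : S → ℝ) :
    (1 - M.γ) * (M.regValue r α θ₀ θ - ∑ s, M.ρ s * V s)
      = ∑ s, M.sVisit (softmax θ) s * (∑ a, softmax θ s a * M.qval r V s a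
          - α * kl (softmax θ s) (softmax θ₀ s) - V s) := by
  have h := M.value_sub (isPolicy_softmax θ) r V
  have hγ := M.one_sub_γ_pos.ne'
  have e : (1 - M.γ) * (M.regValue r α θ₀ θ - ∑ s, M.ρ s * V s)
      = (1 - M.γ) * (M.value (softmax θ) r - ∑ s, M.ρ s * V s)
        - α * M.policyKL (softmax θ) (softmax θ₀) := by
    rw [regValue]; field_simp; ring
  rw [e, h, policyKL, mul_sum, ← sum_sub_distrib]
  refine sum_congr rfl fun s _ => ?_
  simp only [qval]
  ring

/-- The policy gradient theorem. The baseline `V` is frozen at the current `θ`, where every bracket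
in `regValue_sub` vanishes, so continuity of the visitation weights suffices. -/
theorem hasFDerivAt_regValue [Nonempty A] (r : S → A → ℝ) (α : ℝ) (θ₀ θ : S × A → ℝ) {V : S → ℝ}
    (hV : M.IsRegValue r α (softmax θ₀) (softmax θ) V) :
    HasFDerivAt (M.regValue r α θ₀)
      ((1 - M.γ)⁻¹ • ∑ s, M.sVisit (softmax θ) s • ∑ a, (softmax θ s a
        * (M.qval r V s a - α * Real.log (softmax θ s a / softmax θ₀ s a))) • score θ s a) θ := by
  have hγ := M.one_sub_γ_pos.ne'
  have hform : M.regValue r α θ₀ = fun θ' => ∑ s, M.ρ s * V s + (1 - M.γ)⁻¹ *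
      ∑ s, M.sVisit (softmax θ') s * (∑ a, softmax θ' s a * M.qval r V s a
          - α * kl (softmax θ' s) (softmax θ₀ s) - V s) := by
    ext θ'
    rw [← M.regValue_sub r α θ₀ θ' V, inv_mul_cancel_left₀ hγ]
    ring
  rw [hform]
  refine ((HasFDerivAt.fun_sum fun s _ => hasFDerivAt_mul_of_continuousAt
    (M.continuous_sVisit s).continuousAt ?_ ?_).const_mul (1 - M.γ)⁻¹).const_add _
  · have e : ∀ θ' : S × A → ℝ, ∑ a, softmax θ' s a * M.qval r V s a
          - α * kl (softmax θ' s) (softmax θ₀ s) - V s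
        = ∑ a, softmax θ' s a * (M.qval r V s a - α * (Real.log (softmax θ' s a)
          - Real.log (softmax θ₀ s a))) - V s := by
      intro θ'
      rw [kl, mul_sum, ← sum_sub_distrib]
      congr 1
      refine sum_congr rfl fun a _ => ?_
      rw [Real.log_div (softmax_pos _ _ _).ne' (softmax_pos _ _ _).ne']
      ring
    simp only [e]
    refine ((HasFDerivAt.fun_sum fun a _ => (hasFDerivAt_softmax θ s a).mul
      (((((hasFDerivAt_log_softmax θ s a).sub_const _).const_mul α).const_sub _))).sub_const
        _).congr_fderiv ?_
    rw [sum_add_distrib]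
    -- The derivative of the logarithm inside the divergence drops out because the score has mean
    -- zero.
    have h0 : ∑ a, softmax θ s a • -(α • score θ s a) = 0 := by
      have := congrArg (fun x => -(α • x)) (sum_softmax_smul_score θ s)
      simp only [smul_sum, smul_zero, neg_zero] at this
      rw [← this, ← sum_neg_distrib]
      refine sum_congr rfl fun a _ => ?_
      rw [smul_neg, smul_comm]
    rw [h0, zero_add]
    refine sum_congr rfl fun a _ => ?_
    rw [smul_smul, Real.log_div (softmax_pos _ _ _).ne' (softmax_pos _ _ _).ne', mul_comm]
  · rw [← hV s, sub_self]

theorem fisher_mulVec [Nonempty A] (θ w : S × A → ℝ) (p : S × A) :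
    (M.fisher θ *ᵥ w) p = ∑ s, M.sVisit (softmax θ) s * ∑ a, softmax θ s a * score θ s a w
      * grad (fun θ' => Real.log (softmax θ' s a)) θ p := by
  have hs : ∀ s a, score θ s a w = grad (fun θ' => Real.log (softmax θ' s a)) θ ⬝ᵥ w := by
    intro s a
    rw [← (hasFDerivAt_log_softmax θ s a).fderiv, fderiv_eq_sum_grad]
    rfl
  simp only [fisher, Matrix.sum_mulVec, Finset.sum_apply, Matrix.smul_mulVec, Pi.smul_apply,
    Matrix.vecMulVec_mulVec, M.saVisit_eq, hs, mul_sum]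
  refine sum_congr rfl fun s _ => sum_congr rfl fun a _ => ?_
  simp only [smul_eq_mul, MulOpposite.smul_eq_mul_unop, MulOpposite.unop_op]
  ring

/-- The quadratic form of the Fisher matrix is the mean squared score, a sum of nonnegative terms.
-/
theorem score_eq_of_fisher_mulVec_eq_zero [Nonempty A] {θ z : S × A → ℝ}
    (hz : M.fisher θ *ᵥ z = 0) {s : S} (hs : 0 < M.sVisit (softmax θ) s) (a : A) :
    score θ s a z = 0 := by
  have h : ∑ s, ∑ a, M.sVisit (softmax θ) s * (softmax θ s a * score θ s a z ^ 2) = 0 := by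
    have h1 : z ⬝ᵥ (M.fisher θ *ᵥ z) = 0 := by rw [hz, dotProduct_zero]
    rw [← h1, dotProduct]
    simp only [fisher_mulVec]
    simp only [mul_sum]
    conv_rhs => rw [sum_comm]
    refine sum_congr rfl fun s _ => ?_
    conv_rhs => rw [sum_comm]
    refine sum_congr rfl fun a _ => ?_
    have hs : score θ s a z = ∑ p, grad (fun θ' => Real.log (softmax θ' s a)) θ p * z p := by
      rw [← (hasFDerivAt_log_softmax θ s a).fderiv, fderiv_eq_sum_grad]
    rw [pow_two]
    nth_rewrite 2 [hs]
    simp only [mul_sum]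
    exact sum_congr rfl fun p _ => by ring
  have hnn : ∀ s a, 0 ≤ M.sVisit (softmax θ) s * (softmax θ s a * score θ s a z ^ 2) :=
    fun s a => mul_nonneg (M.sVisit_nonneg (isPolicy_softmax θ) s)
      (mul_nonneg (softmax_pos θ s a).le (sq_nonneg _))
  have h2 := (sum_eq_zero_iff_of_nonneg fun s _ => sum_nonneg fun a _ => hnn s a).1 h s (mem_univ s)
  have h3 := (sum_eq_zero_iff_of_nonneg fun a _ => hnn s a).1 h2 a (mem_univ a)
  have h4 := (mul_eq_zero.1 h3).resolve_left hs.ne'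
  exact pow_eq_zero_iff (two_ne_zero) |>.1 ((mul_eq_zero.1 h4).resolve_left (softmax_pos θ s a).ne')

/-- On reachable states a natural policy gradient step with `η = (1 - γ) / α` is a step of soft
policy iteration. -/
theorem npgStep_apply [Nonempty A] (r : S → A → ℝ) {α η : ℝ} (hα : 0 < α)
    (hη : η = (1 - M.γ) / α) (θ₀ θ : S × A → ℝ) {V : S → ℝ}
    (hV : M.IsRegValue r α (softmax θ₀) (softmax θ) V) {s : S} (hs : M.Reach s) :
    ∃ κ : ℝ, ∀ a, M.npgStep r α η θ₀ θ (s, a) = θ₀ (s, a) + M.qval r V s a / α + κ := by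
  have hγ := M.one_sub_γ_pos.ne'
  set w : S × A → ℝ := fun p => (1 - M.γ)⁻¹ * (M.qval r V p.1 p.2
    - α * Real.log (softmax θ p.1 p.2 / softmax θ₀ p.1 p.2)) with hw
  -- The gradient lies in the range of the Fisher matrix; centring by the score is free because the
  -- score has mean zero.
  have hgrad : grad (M.regValue r α θ₀) θ = M.fisher θ *ᵥ w := by
    classical
    ext p
    rw [M.fisher_mulVec, grad_eq_of_hasFDerivAt (M.hasFDerivAt_regValue r α θ₀ θ hV)]
    have hg := fun s a => grad_eq_of_hasFDerivAt (hasFDerivAt_log_softmax θ s a) p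
    simp only [_root_.smul_apply, _root_.sum_apply, smul_eq_mul]
    rw [mul_sum]
    refine sum_congr rfl fun s _ => ?_
    rw [mul_left_comm]
    congr 1
    have h0 : ∑ a, softmax θ s a * grad (fun θ' => Real.log (softmax θ' s a)) θ p = 0 := by
      have := congrArg (fun f : (S × A → ℝ) →L[ℝ] ℝ => f (Pi.single p 1))
        (sum_softmax_smul_score θ s)
      simpa [hg] using this
    have h1 : ∑ a, softmax θ s a * score θ s a w
          * grad (fun θ' => Real.log (softmax θ' s a)) θ p
        = ∑ a, softmax θ s a * w (s, a) * grad (fun θ' => Real.log (softmax θ' s a)) θ p := by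
      have e : ∀ a, softmax θ s a * score θ s a w
            * grad (fun θ' => Real.log (softmax θ' s a)) θ p
          = softmax θ s a * w (s, a) * grad (fun θ' => Real.log (softmax θ' s a)) θ p
            - (∑ b, softmax θ s b * w (s, b))
              * (softmax θ s a * grad (fun θ' => Real.log (softmax θ' s a)) θ p) := by
        intro a; rw [score_apply]; ring
      simp only [e]
      rw [sum_sub_distrib, ← mul_sum, h0, mul_zero, sub_zero]
    rw [h1, mul_sum]
    refine sum_congr rfl fun a _ => ?_
    rw [hg]
    simp only [hw]
    ring
  have hker := mulVec_pinv_mulVec_sub (M.fisher θ) w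
  set u := pinv (M.fisher θ) *ᵥ (M.fisher θ *ᵥ w) with hu
  have hd := M.sVisit_pos (isPolicy_softmax θ) (softmax_pos θ) hs
  -- The pseudoinverse recovers `w` up to a kernel vector, which at a visited state is constant in
  -- the action and invisible to softmax.
  have hz : ∀ a, u (s, a) = w (s, a) + ∑ b, softmax θ s b * (u - w) (s, b) := fun a => by
    have := M.score_eq_of_fisher_mulVec_eq_zero hker hd a
    rw [score_apply, Pi.sub_apply] at this
    linarith
  refine ⟨η * ∑ b, softmax θ s b * (u - w) (s, b)
    + (Real.log (∑ b, Real.exp (θ (s, b))) - Real.log (∑ b, Real.exp (θ₀ (s, b)))), fun a => ?_⟩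
  rw [npgStep, hgrad, ← hu, Pi.add_apply, Pi.smul_apply, smul_eq_mul, hz a, mul_add]
  -- With `η = (1 - γ) / α` the log-ratio cancels `θ` up to an action-independent shift, leaving the
  -- anchor plus scaled action values.
  have : η * w (s, a) = M.qval r V s a / α
      - Real.log (softmax θ s a / softmax θ₀ s a) := by
    simp only [hw, hη]; field_simp
  rw [this, Real.log_div (softmax_pos _ _ _).ne' (softmax_pos _ _ _).ne', log_softmax, log_softmax]
  ring

end MOMDP

/-- The Gibbs variational identity. -/
theorem exists_gibbs {S A : Type*} [Fintype A] [Nonempty A] {θ₀ θ : S × A → ℝ} {s : S} {α κ : ℝ}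
    {Q : A → ℝ} (hα : 0 < α) (h : ∀ a, θ (s, a) = θ₀ (s, a) + Q a / α + κ) :
    ∃ W : ℝ, ∀ x ∈ stdSimplex ℝ A, ∑ a, x a * Q a - α * kl x (softmax θ₀ s)
      = W - α * kl x (softmax θ s) := by
  refine ⟨α * (Real.log (∑ b, Real.exp (θ (s, b))) - Real.log (∑ b, Real.exp (θ₀ (s, b))) - κ),
    fun x hx => ?_⟩
  have e : ∀ a, x a * Real.log (softmax θ s a / softmax θ₀ s a) = x a * Q a / α
      - x a * (Real.log (∑ b, Real.exp (θ (s, b))) - Real.log (∑ b, Real.exp (θ₀ (s, b))) - κ) := by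
    intro a
    rw [Real.log_div (softmax_pos _ _ _).ne' (softmax_pos _ _ _).ne', log_softmax, log_softmax, h]
    ring
  rw [kl_eq_add (x := x) (y := softmax θ₀ s) (z := softmax θ s)
    fun a _ => ⟨(softmax_pos _ _ _).ne', (softmax_pos _ _ _).ne'⟩]
  simp only [e]
  rw [sum_sub_distrib, ← sum_mul, hx.2, ← sum_div]
  field_simp
  ring

/-! ### Convergence of the inner loop -/

namespace MOMDP
variable {S A : Type*} [Fintype S] [Fintype A] {m : ℕ} (M : MOMDP S A m)

theorem avg_qval_sub (r : S → A → ℝ) (x : A → ℝ) (U V : S → ℝ) (s : S) :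
    ∑ a, x a * M.qval r U s a - ∑ a, x a * M.qval r V s a
      = M.γ * ∑ a, x a * M.next (fun s => U s - V s) s a := by
  rw [← sum_sub_distrib, mul_sum]
  refine sum_congr rfl fun a _ => ?_
  rw [qval, qval, next_sub]
  ring

variable {M}

/-- The regularizer only lowers the value. -/
theorem IsRegValue.le {r : S → A → ℝ} {α L : ℝ} {π₀ π : S → A → ℝ} {V : S → ℝ}
    (hV : M.IsRegValue r α π₀ π V) (hα : 0 < α) (hr : ∀ s a, |r s a| ≤ L) (hπ₀ : IsPolicy π₀)
    (hπ : IsPolicy π) (hp : ∀ s a, 0 < π₀ s a) {s : S} (hs : M.Reach s) :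
    V s ≤ L / (1 - M.γ) := by
  refine M.le_of_le_bellman hπ (fun s _ => ?_) hs
  have h1 := mul_nonneg hα.le (kl_nonneg (hπ s) (hπ₀ s) fun a h => absurd h (hp s a).ne')
  have h2 := hπ.avg_le s fun a => (abs_le.1 (hr s a)).2
  have h3 : ∑ a, π s a * M.qval r V s a
      = ∑ a, π s a * r s a + M.γ * ∑ a, π s a * M.next V s a := by
    rw [mul_sum, ← sum_add_distrib]
    exact sum_congr rfl fun a _ => by rw [qval]; ring
  rw [hV s, h3]
  linarith

/-- At the anchor the divergence vanishes, so only the reward contributes. -/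
theorem IsRegValue.anchor_ge {r : S → A → ℝ} {α L : ℝ} {π₀ : S → A → ℝ} {V : S → ℝ}
    (hV : M.IsRegValue r α π₀ π₀ V) (hr : ∀ s a, |r s a| ≤ L) (hπ₀ : IsPolicy π₀)
    {s : S} (hs : M.Reach s) : -V s ≤ L / (1 - M.γ) := by
  refine M.le_of_le_bellman hπ₀ (u := fun s => -V s) (fun s _ => ?_) hs
  have h2 := hπ₀.avg_le s (f := fun a => -r s a) fun a => neg_le.1 (abs_le.1 (hr s a)).1
  have h3 : ∑ a, π₀ s a * M.qval r V s a
      = -(∑ a, π₀ s a * -r s a) - M.γ * ∑ a, π₀ s a * M.next (fun s => -V s) s a := by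
    rw [mul_sum, ← sum_neg_distrib, ← sum_sub_distrib]
    exact sum_congr rfl fun a _ => by simp only [qval, next, mul_neg, sum_neg_distrib]; ring
  simp only [hV s, kl_self, h3]
  linarith

variable (M)

/-- Approximate optimality of the inner loop in the form used by mirror descent. -/
theorem innerLoop_spec [Nonempty A] {r : S → A → ℝ} {α η L : ℝ} (hα : 0 < α)
    (hη : η = (1 - M.γ) / α) (hr : ∀ s a, |r s a| ≤ L) (θ₀ : S × A → ℝ) (n : ℕ) :
    ∃ w : ℝ, ∀ π : S → A → ℝ, IsPolicy π →
      w ≤ (1 - M.γ) * M.value π r - α * M.policyKL π (softmax θ₀)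
        + α * M.policyKL π (softmax (M.innerLoop θ₀ r α η (n + 1))) ∧
      (1 - M.γ) * M.value π r - α * M.policyKL π (softmax θ₀)
        + α * M.policyKL π (softmax (M.innerLoop θ₀ r α η (n + 1)))
        ≤ w + M.γ ^ n * (2 * L / (1 - M.γ)) := by
  have hγ := M.one_sub_γ_pos
  set θ : ℕ → S × A → ℝ := fun n => M.innerLoop θ₀ r α η n with hθ
  have hπ : ∀ n, IsPolicy (softmax (θ n)) := fun n => isPolicy_softmax _
  have hstep : ∀ n, θ (n + 1) = M.npgStep r α η θ₀ (θ n) := fun n =>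
    Function.iterate_succ_apply' _ n θ₀
  choose V hV using fun n => M.exists_isRegValue r α (softmax θ₀) (hπ n)
  -- `W n` is the soft-max backup of `V n`, attained by the policy of `θ (n + 1)`; off the reachable
  -- states any value serves.
  have hWex : ∀ n s, ∃ W : ℝ, M.Reach s → ∀ x ∈ stdSimplex ℝ A,
      ∑ a, x a * M.qval r (V n) s a - α * kl x (softmax θ₀ s)
        = W - α * kl x (softmax (θ (n + 1)) s) := by
    intro n s
    by_cases hs : M.Reach s
    · obtain ⟨κ, hκ⟩ := M.npgStep_apply r hα hη θ₀ (θ n) (hV n) hs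
      obtain ⟨W, hW⟩ := exists_gibbs (θ := θ (n + 1)) hα fun a => by rw [hstep]; exact hκ a
      exact ⟨W, fun _ => hW⟩
    · exact ⟨0, fun h => absurd h hs⟩
  choose W hW using hWex
  have hkl : ∀ (n : ℕ) (s : S) (x : A → ℝ), x ∈ stdSimplex ℝ A →
      0 ≤ α * kl x (softmax (θ n) s) := fun n s x hx =>
    mul_nonneg hα.le (kl_nonneg hx (hπ n s) fun a h => absurd h (softmax_pos _ s a).ne')
  have hVW : ∀ n s, M.Reach s → V n s ≤ W n s := fun n s hs => by
    rw [hV n s, hW n s hs _ (hπ n s)]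
    linarith [hkl (n + 1) s _ (hπ n s)]
  -- Under the policy of `θ (n + 1)`, `W n - V (n + 1)` is `γ` times the mean of `V n - V (n + 1)`
  -- at the successor, hence at most that of itself; the maximum principle applies with `b = 0`.
  have hWV : ∀ n s, M.Reach s → W n s ≤ V (n + 1) s := fun n s hs => by
    have := M.le_of_le_bellman (hπ (n + 1)) (u := fun s => W n s - V (n + 1) s) (b := 0)
      (fun s hs => ?_) hs
    · simpa using this
    have h1 := hW n s hs _ (hπ (n + 1) s)
    rw [kl_self, mul_zero, sub_zero] at h1
    have h2 := M.avg_qval_sub r (softmax (θ (n + 1)) s) (V n) (V (n + 1)) s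
    have h3 : ∑ a, softmax (θ (n + 1)) s a * M.next (fun s => V n s - V (n + 1) s) s a
        ≤ ∑ a, softmax (θ (n + 1)) s a * M.next (fun s => W n s - V (n + 1) s) s a :=
      sum_le_sum fun a _ => mul_le_mul_of_nonneg_left
        (M.next_mono (fun s hs => sub_le_sub_right (hVW n s hs) _) hs a) (softmax_pos _ s a).le
    have h4 := mul_le_mul_of_nonneg_left h3 M.γ_pos.le
    simp only [← h1]
    rw [hV (n + 1) s]
    linarith
  -- Comparing with values of the same run makes an optimal regularized value function unnecessary.
  have hU : ∀ k, ∀ n s, M.Reach s → V k s - V n s ≤ M.γ ^ n * (2 * L / (1 - M.γ)) := by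
    intro k n
    induction n with
    | zero =>
      intro s hs
      have h1 := (hV k).le hα hr (isPolicy_softmax θ₀) (hπ k) (softmax_pos θ₀) hs
      have h2 := (hV 0).anchor_ge hr (isPolicy_softmax θ₀) hs
      rw [pow_zero, one_mul, two_mul, add_div]
      linarith
    | succ n ih =>
      intro s hs
      have h1 := hWV n s hs
      have h2 := hW n s hs _ (hπ k s)
      have h3 := hkl (n + 1) s _ (hπ k s)
      have h4 := M.avg_qval_sub r (softmax (θ k) s) (V k) (V n) s
      have h5 := mul_le_mul_of_nonneg_left
        ((hπ k).avg_le s fun a => M.next_le ih hs a) M.γ_pos.le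
      rw [pow_succ', mul_assoc, hV k s]
      linarith
  have hgap : ∀ s, M.Reach s → W n s - V n s ≤ M.γ ^ n * (2 * L / (1 - M.γ)) := fun s hs => by
    linarith [hWV n s hs, hU (n + 1) n s hs]
  refine ⟨(1 - M.γ) * ∑ s, M.ρ s * W n s, fun π hpi => ?_⟩
  -- With baseline `W n`, the Gibbs identity becomes an exact formula whose only `π`-dependent term
  -- is an average of `W n - V n`, bounded on both sides.
  have hid : (1 - M.γ) * M.value π r - α * M.policyKL π (softmax θ₀)
        + α * M.policyKL π (softmax (θ (n + 1)))
      = (1 - M.γ) * ∑ s, M.ρ s * W n s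
        + ∑ s, M.sVisit π s * (M.γ * ∑ a, π s a * M.next (fun s => W n s - V n s) s a) := by
    have h := M.value_sub hpi r (W n)
    have e : ∑ s, M.sVisit π s * (∑ a, π s a * (r s a + M.γ * M.next (W n) s a) - W n s)
        = ∑ s, M.sVisit π s * (M.γ * ∑ a, π s a * M.next (fun s => W n s - V n s) s a
          + α * kl (π s) (softmax θ₀ s) - α * kl (π s) (softmax (θ (n + 1)) s)) := by
      refine M.sum_sVisit_congr fun s hs => ?_
      have h1 := hW n s hs _ (hpi s)
      have h2 := M.avg_qval_sub r (π s) (W n) (V n) s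
      change ∑ a, π s a * M.qval r (W n) s a - W n s = _
      linarith
    rw [e] at h
    simp only [mul_sub, mul_add, sum_add_distrib, sum_sub_distrib] at h
    have h3 : ∀ π', α * M.policyKL π π' = ∑ s, M.sVisit π s * (α * kl (π s) (π' s)) := fun π' => by
      rw [policyKL, mul_sum]
      exact sum_congr rfl fun s _ => by ring
    rw [h3, h3]
    linarith
  rw [show M.innerLoop θ₀ r α η (n + 1) = θ (n + 1) from rfl, hid]
  constructor
  · refine le_add_of_nonneg_right (sum_nonneg fun s _ => ?_)
    by_cases hs : M.Reach s
    · refine mul_nonneg (M.sVisit_nonneg hpi s) (mul_nonneg M.γ_pos.le (sum_nonneg fun a _ =>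
        mul_nonneg ((hpi s).1 a) ?_))
      have := M.next_mono (f := fun _ => 0) (g := fun s => W n s - V n s)
        (fun s hs => sub_nonneg.2 (hVW n s hs)) hs a
      simpa [next] using this
    · simp [M.sVisit_eq_zero hs]
  · refine add_le_add_right ?_ _
    -- Nonnegativity is read off from `0 ≤ W n - V n` and `hgap` at a state charged by `ρ`.
    have hb : 0 ≤ M.γ ^ n * (2 * L / (1 - M.γ)) := by
      obtain ⟨s, hs⟩ : ∃ s, M.ρ s ≠ 0 := by
        by_contra! h
        have := M.ρ_mem.2
        simp [h] at this
      have h1 := hVW n s (.init hs)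
      have h2 := hgap s (.init hs)
      linarith
    calc _ ≤ ∑ s, M.sVisit π s * (M.γ ^ n * (2 * L / (1 - M.γ))) := by
          refine M.sum_sVisit_le hpi fun s hs => ?_
          have h1 := hpi.avg_le s fun a => M.next_le hgap hs a
          have h2 := mul_le_mul_of_nonneg_left h1 M.γ_pos.le
          exact h2.trans (mul_le_of_le_one_left hb M.γ_lt_one.le)
      _ = _ := by rw [← sum_mul, M.sum_sVisit hpi, one_mul]

end MOMDP

/-! ### Norm duality and sums -/

theorem abs_sum_mul_le {ι : Type*} [Fintype ι] (x y : ι → ℝ) :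
    |∑ i, x i * y i| ≤ l1 x * ‖y‖ := by
  refine (abs_sum_le_sum_abs _ _).trans ?_
  rw [l1, sum_mul]
  refine sum_le_sum fun i _ => ?_
  rw [abs_mul]
  exact mul_le_mul_of_nonneg_left (norm_le_pi_norm y i) (abs_nonneg _)

theorem l1_nonneg {ι : Type*} [Fintype ι] (x : ι → ℝ) : 0 ≤ l1 x :=
  sum_nonneg fun _ _ => abs_nonneg _

theorem l1_add_le {ι : Type*} [Fintype ι] (x y : ι → ℝ) : l1 (x + y) ≤ l1 x + l1 y := by
  rw [l1, l1, l1, ← sum_add_distrib]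
  exact sum_le_sum fun i _ => abs_add_le _ _

theorem sum_Icc_one_eq_sum_range {E : Type*} [AddCommMonoid E] (f : ℕ → E) (K : ℕ) :
    ∑ k ∈ Icc 1 K, f k = ∑ k ∈ range K, f (k + 1) := by
  induction K with
  | zero => simp
  | succ K ih => rw [sum_Icc_succ_top (by omega), ih, sum_range_succ]

/-! ### The primal half of a macro step -/

namespace MOMDP
variable {S A : Type*} [Fintype S] [Fintype A] {m : ℕ} (M : MOMDP S A m)

/-- Values are linear in the reward, so the inner loop maximizes the linearization of `Φ` in value
space. -/
theorem value_ascentReward {π : S → A → ℝ} (hπ : IsPolicy π)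
    (Φ : (Fin m → ℝ) → (Fin m → ℝ) → ℝ) (p : S → A → ℝ) (l : Fin m → ℝ) :
    M.value π (ascentReward M Φ p l) = ∑ i, gradV Φ (M.valueVec p) l i * M.valueVec π i := by
  refine mul_left_cancel₀ M.one_sub_γ_pos.ne' ?_
  have h : ∀ i, (1 - M.γ) * (gradV Φ (M.valueVec p) l i * M.valueVec π i)
      = gradV Φ (M.valueVec p) l i * ∑ s, M.sVisit π s * ∑ a, π s a * M.r i s a := fun i => by
    rw [← M.value_eq hπ, valueVec]; ring
  rw [M.value_eq hπ, mul_sum]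
  simp only [h, ascentReward, mul_sum]
  exact (sum_congr rfl fun s _ => sum_comm).trans (sum_comm.trans (sum_congr rfl fun i _ =>
    sum_congr rfl fun s _ => sum_congr rfl fun a _ => by ring))

theorem abs_ascentReward_le {Φ : (Fin m → ℝ) → (Fin m → ℝ) → ℝ} {p : S → A → ℝ} {l : Fin m → ℝ}
    {L : ℝ} (h : l1 (gradV Φ (M.valueVec p) l) ≤ L) (s : S) (a : A) :
    |ascentReward M Φ p l s a| ≤ L := by
  refine le_trans ((abs_sum_le_sum_abs _ _).trans (sum_le_sum fun i _ => ?_)) h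
  rw [abs_mul, abs_of_nonneg (M.r_mem i s a).1]
  exact mul_le_of_le_one_right (abs_nonneg _) (M.r_mem i s a).2

theorem valueVec_sub_sq_le [Nonempty A] {π π' : S → A → ℝ} (hπ : IsPolicy π) (hπ' : IsPolicy π')
    (hp : ∀ s a, 0 < π' s a) :
    ‖M.valueVec π - M.valueVec π'‖ ^ 2 ≤ 2 * M.policyKL π π' / (1 - M.γ) ^ 4 := by
  have hγ := M.one_sub_γ_pos
  have h0 := M.policyKL_nonneg hπ hπ' hp
  have hn : 0 ≤ 2 * M.policyKL π π' / (1 - M.γ) ^ 4 := by positivity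
  have : ‖M.valueVec π - M.valueVec π'‖ ≤ √(2 * M.policyKL π π' / (1 - M.γ) ^ 4) :=
    (pi_norm_le_iff_of_nonneg (Real.sqrt_nonneg _)).2 fun i =>
      Real.abs_le_sqrt (M.value_sub_sq_le hπ hπ' hp (M.r_mem i))
  calc _ ≤ (√(2 * M.policyKL π π' / (1 - M.γ) ^ 4)) ^ 2 :=
        pow_le_pow_left₀ (norm_nonneg _) this 2
    _ = _ := Real.sq_sqrt hn

/-- The calibration of `α`: the divergence becomes strongly convex in the value vector at the scale
of the smoothness `β`. -/
theorem three_mul_norm_sq_le [Nonempty A] {α β : ℝ} (hβ : 0 < β) (hα : 6 * β / (1 - M.γ) ^ 3 ≤ α)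
    {π π' : S → A → ℝ} (hπ : IsPolicy π) (hπ' : IsPolicy π') (hp : ∀ s a, 0 < π' s a) :
    3 * β * ‖M.valueVec π - M.valueVec π'‖ ^ 2 ≤ α / (1 - M.γ) * M.policyKL π π' := by
  have hγ := M.one_sub_γ_pos
  have h1 := M.valueVec_sub_sq_le hπ hπ' hp
  calc 3 * β * ‖M.valueVec π - M.valueVec π'‖ ^ 2
      ≤ 3 * β * (2 * M.policyKL π π' / (1 - M.γ) ^ 4) :=
        mul_le_mul_of_nonneg_left h1 (by positivity)
    _ = 6 * β / (1 - M.γ) ^ 3 / (1 - M.γ) * M.policyKL π π' := by field_simp; ring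
    _ ≤ _ := mul_le_mul_of_nonneg_right (div_le_div_of_nonneg_right hα hγ.le)
        (M.policyKL_nonneg hπ hπ' hp)

/-- The constant of `innerLoop_spec` serves all policies: subtract its lower bound at the output
from its upper bound at `π`. -/
theorem innerLoop_three_point [Nonempty A] {r : S → A → ℝ} {α η L : ℝ} (hα : 0 < α)
    (hη : η = (1 - M.γ) / α) (hr : ∀ s a, |r s a| ≤ L) (θ₀ : S × A → ℝ) (n : ℕ)
    {π : S → A → ℝ} (hπ : IsPolicy π) {θ : S × A → ℝ} (hθ : θ = M.innerLoop θ₀ r α η (n + 1)) :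
    M.value π r - M.value (softmax θ) r
      ≤ α / (1 - M.γ) * (M.policyKL π (softmax θ₀) - M.policyKL π (softmax θ)
        - M.policyKL (softmax θ) (softmax θ₀)) + M.γ ^ n * (2 * L) / (1 - M.γ) ^ 2 := by
  have hγ := M.one_sub_γ_pos
  obtain ⟨w, hw⟩ := M.innerLoop_spec hα hη hr θ₀ n
  rw [← hθ] at hw
  have h1 := (hw π hπ).2
  have h2 := (hw (softmax θ) (isPolicy_softmax θ)).1
  rw [policyKL_self] at h2
  have h3 : (1 - M.γ) * (M.value π r - M.value (softmax θ) r)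
      ≤ (1 - M.γ) * (α / (1 - M.γ) * (M.policyKL π (softmax θ₀) - M.policyKL π (softmax θ)
        - M.policyKL (softmax θ) (softmax θ₀)) + M.γ ^ n * (2 * L) / (1 - M.γ) ^ 2) := by
    have e : (1 - M.γ) * (α / (1 - M.γ) * (M.policyKL π (softmax θ₀) - M.policyKL π (softmax θ)
        - M.policyKL (softmax θ) (softmax θ₀)) + M.γ ^ n * (2 * L) / (1 - M.γ) ^ 2)
        = α * (M.policyKL π (softmax θ₀) - M.policyKL π (softmax θ)
        - M.policyKL (softmax θ) (softmax θ₀)) + M.γ ^ n * (2 * L / (1 - M.γ)) := by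
      field_simp
    rw [e]
    linarith
  exact le_of_mul_le_mul_left h3 hγ

/-- One extragradient step on the policy. -/
theorem primal_step [Nonempty A] {α β η L : ℝ} (hβ : 0 < β) (hα : 6 * β / (1 - M.γ) ^ 3 ≤ α)
    (hη : η = (1 - M.γ) / α) {Φ : (Fin m → ℝ) → (Fin m → ℝ) → ℝ} {p₀ p₁ : S → A → ℝ}
    {l₀ l₁ : Fin m → ℝ} (h₀ : l1 (gradV Φ (M.valueVec p₀) l₀) ≤ L)
    (h₁ : l1 (gradV Φ (M.valueVec p₁) l₁) ≤ L) (n : ℕ) {θ₀ θ₁ θ₂ : S × A → ℝ}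
    (hθ₁ : θ₁ = M.innerLoop θ₀ (ascentReward M Φ p₀ l₀) α η (n + 1))
    (hθ₂ : θ₂ = M.innerLoop θ₀ (ascentReward M Φ p₁ l₁) α η (n + 1))
    {π : S → A → ℝ} (hπ : IsPolicy π) :
    ∑ i, gradV Φ (M.valueVec p₁) l₁ i * (M.valueVec π i - M.valueVec (softmax θ₁) i)
      ≤ α / (1 - M.γ) * (M.policyKL π (softmax θ₀) - M.policyKL π (softmax θ₂))
        - 3 * β * ‖M.valueVec (softmax θ₁) - M.valueVec (softmax θ₀)‖ ^ 2
        - 3 * β * ‖M.valueVec (softmax θ₂) - M.valueVec (softmax θ₁)‖ ^ 2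
        + l1 (gradV Φ (M.valueVec p₁) l₁ - gradV Φ (M.valueVec p₀) l₀)
          * ‖M.valueVec (softmax θ₂) - M.valueVec (softmax θ₁)‖
        + 2 * (M.γ ^ n * (2 * L) / (1 - M.γ) ^ 2) := by
  have hα0 : 0 < α := lt_of_lt_of_le (div_pos (by positivity) (pow_pos M.one_sub_γ_pos 3)) hα
  -- Taking the second output as competitor of the first makes its divergence from the anchor cancel
  -- against the one in `hB`.
  have hA := M.innerLoop_three_point hα0 hη (M.abs_ascentReward_le h₀) θ₀ n
    (isPolicy_softmax θ₂) hθ₁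
  have hB := M.innerLoop_three_point hα0 hη (M.abs_ascentReward_le h₁) θ₀ n hπ hθ₂
  simp only [M.value_ascentReward hπ, M.value_ascentReward (isPolicy_softmax _),
    ← sum_sub_distrib, ← mul_sub] at hA hB
  have h1 := M.three_mul_norm_sq_le hβ hα (isPolicy_softmax θ₁) (isPolicy_softmax θ₀)
    (softmax_pos θ₀)
  have h2 := M.three_mul_norm_sq_le hβ hα (isPolicy_softmax θ₂) (isPolicy_softmax θ₁)
    (softmax_pos θ₁)
  have h3 := (le_abs_self _).trans (abs_sum_mul_le
    (gradV Φ (M.valueVec p₁) l₁ - gradV Φ (M.valueVec p₀) l₀)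
    (M.valueVec (softmax θ₂) - M.valueVec (softmax θ₁)))
  have e : ∑ i, gradV Φ (M.valueVec p₁) l₁ i * (M.valueVec π i - M.valueVec (softmax θ₁) i)
      = ∑ i, gradV Φ (M.valueVec p₁) l₁ i * (M.valueVec π i - M.valueVec (softmax θ₂) i)
        + ∑ i, (gradV Φ (M.valueVec p₁) l₁ - gradV Φ (M.valueVec p₀) l₀) i
          * (M.valueVec (softmax θ₂) - M.valueVec (softmax θ₁)) i
        + ∑ i, gradV Φ (M.valueVec p₀) l₀ i
          * (M.valueVec (softmax θ₂) i - M.valueVec (softmax θ₁) i) := by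
    rw [← sum_add_distrib, ← sum_add_distrib]
    refine sum_congr rfl fun i _ => ?_
    simp only [Pi.sub_apply]
    ring
  rw [e]
  linarith

end MOMDP

/-! ### The dual half of a macro step -/

/-- The extragradient argument of `primal_step` with exact minimizers; Pinsker and `1 / η' ≥ 6β`
give the coefficients `3β`. -/
theorem dual_step {m : ℕ} {Λ : Set (Fin m → ℝ)} {g₀ g₁ l₀ l₁ l₂ : Fin m → ℝ} {η' β : ℝ}
    (hΛ : Λ ⊆ stdSimplex ℝ (Fin m)) (hconv : Convex ℝ Λ) (hl₀ : l₀ ∈ stdSimplex ℝ (Fin m))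
    (hsupp : ∀ l ∈ Λ, ∀ i, l₀ i = 0 → l i = 0) (hη : 0 < η') (hβ : 0 < β)
    (hηβ : η' ≤ 1 / (6 * β)) (h₁ : IsDualStep Λ g₀ l₀ η' l₁) (h₂ : IsDualStep Λ g₁ l₀ η' l₂)
    {l : Fin m → ℝ} (hl : l ∈ Λ) :
    ∑ i, g₁ i * (l₁ i - l i) ≤ (kl l l₀ - kl l l₂) / η'
      - 3 * β * l1 (l₁ - l₀) ^ 2 - 3 * β * l1 (l₂ - l₁) ^ 2 + ‖g₁ - g₀‖ * l1 (l₂ - l₁) := by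
  have hA := h₁.three_point hΛ hconv hsupp hη h₂.1
  have hB := h₂.three_point hΛ hconv hsupp hη hl
  have hs := h₁.support hΛ hconv hsupp hη
  have key : ∀ x : ℝ, ∀ y : ℝ, x ^ 2 ≤ 2 * y → 3 * β * x ^ 2 ≤ y / η' := by
    intro x y hxy
    rw [le_div_iff₀ hη]
    rw [le_div_iff₀ (by positivity)] at hηβ
    nlinarith [sq_nonneg x]
  have h1 := key _ _ (l1_sq_le_two_mul_kl (hΛ h₁.1) hl₀ (hsupp l₁ h₁.1))
  have h2 := key _ _ (l1_sq_le_two_mul_kl (hΛ h₂.1) (hΛ h₁.1) (hs l₂ h₂.1))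
  have h3 := (neg_le_abs _).trans (abs_sum_mul_le (l₂ - l₁) (g₁ - g₀))
  have e : ∑ i, g₁ i * (l₁ i - l i) = ∑ i, g₁ i * (l₂ i - l i)
      + -(∑ i, (l₂ - l₁) i * (g₁ - g₀) i) + ∑ i, g₀ i * (l₁ i - l₂ i) := by
    rw [← sum_neg_distrib, ← sum_add_distrib, ← sum_add_distrib]
    refine sum_congr rfl fun i _ => ?_
    simp only [Pi.sub_apply]
    ring
  rw [e]
  simp only [sub_div] at hA hB ⊢
  linarith

/-! ### The max-min criterion -/

section Criterion
variable {m : ℕ} {Φ : (Fin m → ℝ) → (Fin m → ℝ) → ℝ} {D Λ : Set (Fin m → ℝ)} {β : ℝ}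

theorem IsCriterion.exists_minOver (hΦ : IsCriterion Φ D Λ β) {v : Fin m → ℝ} (hv : v ∈ D) :
    ∃ l ∈ Λ, minOver Φ Λ v = Φ v l ∧ ∀ l' ∈ Λ, minOver Φ Λ v ≤ Φ v l' := by
  have hc : IsCompact Λ :=
    (isCompact_stdSimplex ℝ (Fin m)).of_isClosed_subset hΦ.dual_closed hΦ.dual_subset
  obtain ⟨l, hl, hmin⟩ := hc.exists_isMinOn hΦ.dual_nonempty fun l hl =>
    (hΦ.diff_l v hv l (hΦ.dual_subset hl)).continuousAt.continuousWithinAt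
  have hleast : IsLeast ((fun l => Φ v l) '' Λ) (Φ v l) :=
    ⟨⟨l, hl, rfl⟩, by rintro _ ⟨l', hl', rfl⟩; exact hmin hl'⟩
  have e : minOver Φ Λ v = Φ v l := hleast.csInf_eq
  exact ⟨l, hl, e, fun l' hl' => e ▸ hmin hl'⟩

/-- Regret bounds the gap: test the minimum at `v` with the averaged dual iterate, let `l'` be the
minimizer at the averaged value vector, apply Jensen on each side, and linearize at each iterate. -/
theorem IsCriterion.minOver_sub_le (hΦ : IsCriterion Φ D Λ β) {K : ℕ} (hK : 1 ≤ K)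
    {v : Fin m → ℝ} (hv : v ∈ D) {w l : ℕ → Fin m → ℝ} (hw : ∀ k ∈ Icc 1 K, w k ∈ D)
    (hl : ∀ k ∈ Icc 1 K, l k ∈ Λ) {B : ℝ}
    (hB : ∀ l' ∈ Λ, ∑ k ∈ Icc 1 K, (∑ i, gradV Φ (w k) (l k) i * (v i - w k i)
      + ∑ i, gradL Φ (w k) (l k) i * (l k i - l' i)) ≤ B) :
    minOver Φ Λ v - minOver Φ Λ ((1 / (K : ℝ)) • ∑ k ∈ Icc 1 K, w k) ≤ B / K := by
  have hK0 : (0 : ℝ) < K := by exact_mod_cast hK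
  have hw0 : ∀ k ∈ Icc 1 K, (0 : ℝ) ≤ 1 / K := fun _ _ => by positivity
  have hw1 : ∑ _k ∈ Icc 1 K, (1 : ℝ) / K = 1 := by simp [hK0.ne']
  have hbar : (1 / (K : ℝ)) • ∑ k ∈ Icc 1 K, w k ∈ D := by
    rw [smul_sum]; exact hΦ.dom_convex.sum_mem hw0 hw1 hw
  have hlbar : ∑ k ∈ Icc 1 K, (1 / (K : ℝ)) • l k ∈ Λ := hΦ.dual_convex.sum_mem hw0 hw1 hl
  obtain ⟨l', hl', he, -⟩ := hΦ.exists_minOver hbar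
  obtain ⟨-, -, -, hle⟩ := hΦ.exists_minOver hv
  have h1 := (hle _ hlbar).trans ((hΦ.convex v hv).map_sum_le hw0 hw1 hl)
  have h2 := (hΦ.concave l' hl').le_map_sum hw0 hw1 hw
  rw [← smul_sum (f := w), ← he] at h2
  simp only [smul_eq_mul, ← mul_sum] at h1 h2
  have h3 : ∑ k ∈ Icc 1 K, Φ v (l k) - ∑ k ∈ Icc 1 K, Φ (w k) l' ≤ B := by
    refine le_trans ?_ (hB l' hl')
    rw [← sum_sub_distrib]
    refine sum_le_sum fun k hk => ?_
    have h4 := concaveOn_sub_le_grad (hΦ.concave _ (hl k hk)) (hw k hk) hv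
      (hΦ.diff_v _ (hw k hk) _ (hΦ.dual_subset (hl k hk)))
    have h5 := convexOn_grad_le_sub (hΦ.convex _ (hw k hk)) (hl k hk) hl'
      (hΦ.diff_l _ (hw k hk) _ (hΦ.dual_subset (hl k hk)))
    simp only [gradV, gradL]
    linarith
  have h4 := div_le_div_of_nonneg_right h3 hK0.le
  rw [sub_div, div_eq_mul_one_div, mul_comm, div_eq_mul_one_div (∑ k ∈ _, Φ (w k) l'),
    mul_comm (∑ k ∈ _, Φ (w k) l')] at h4
  linarith

end Criterion

/-! ### The macro loop -/

section Run
variable {S A : Type*} [Fintype S] [Fintype A] {m : ℕ} {M : MOMDP S A m}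
  {Φ : (Fin m → ℝ) → (Fin m → ℝ) → ℝ} {D Λ : Set (Fin m → ℝ)} {η' α η β L : ℝ} {t : ℕ → ℕ}
  {K : ℕ} {θ θt : ℕ → S × A → ℝ} {lam lamt : ℕ → Fin m → ℝ}

theorem IsCriterion.uniform_mem (hΦ : IsCriterion Φ D Λ β) :
    (fun _ => 1 / (m : ℝ)) ∈ stdSimplex ℝ (Fin m) ∧ (0 : ℝ) < 1 / m := by
  obtain ⟨l, hl⟩ := hΦ.dual_nonempty
  have hm : 0 < m := by
    rcases Nat.eq_zero_or_pos m with rfl | h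
    · have := (hΦ.dual_subset hl).2
      simp at this
    · exact h
  have hm' : (0 : ℝ) < m := by exact_mod_cast hm
  exact ⟨⟨fun _ => by positivity, by simp [hm'.ne']⟩, by positivity⟩

theorem IsRun.lam_support (hrun : IsRun M Φ Λ η' α η t K θ θt lam lamt)
    (hΦ : IsCriterion Φ D Λ β) (hη : 0 < η') {k : ℕ} (hk : k ≤ K) :
    lam k ∈ stdSimplex ℝ (Fin m) ∧ ∀ l ∈ Λ, ∀ i, lam k i = 0 → l i = 0 := by
  induction k with
  | zero =>
    rw [hrun.init_lam]
    exact ⟨hΦ.uniform_mem.1, fun l _ i h => absurd h hΦ.uniform_mem.2.ne'⟩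
  | succ k ih =>
    have h := hrun.step_lam k hk
    exact ⟨hΦ.dual_subset h.1, h.support hΦ.dual_subset hΦ.dual_convex (ih (by omega)).2 hη⟩

/-- Only the simplex is claimed, as the uniform start may lie outside `Λ`. -/
theorem IsRun.lamt_mem (hrun : IsRun M Φ Λ η' α η t K θ θt lam lamt)
    (hΦ : IsCriterion Φ D Λ β) {k : ℕ} (hk : k ≤ K) : lamt k ∈ stdSimplex ℝ (Fin m) := by
  cases k with
  | zero => rw [hrun.init_lamt]; exact hΦ.uniform_mem.1
  | succ k => exact hΦ.dual_subset (hrun.step_lamt k hk).1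

/-- The regret of one macro step, with telescoping terms. -/
theorem IsRun.step_regret_le [Nonempty A] (hrun : IsRun M Φ Λ η' α η t K θ θt lam lamt)
    (hΦ : IsCriterion Φ D Λ β) (hD : ∀ θ : S × A → ℝ, M.valueVec (softmax θ) ∈ D)
    (hL : ∀ v ∈ D, ∀ l ∈ stdSimplex ℝ (Fin m), l1 (gradV Φ v l) ≤ L) (hβ : 0 < β)
    (hη' : 0 < η') (hη'β : η' ≤ 1 / (6 * β)) (hα : 6 * β / (1 - M.γ) ^ 3 ≤ α)
    (hη : η = (1 - M.γ) / α) {n : ℕ} (ht : ∀ k, t k = n + 1) {π : S → A → ℝ} (hπ : IsPolicy π)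
    {l : Fin m → ℝ} (hl : l ∈ Λ) {k : ℕ} (hk : k < K) :
    ∑ i, gradV Φ (M.valueVec (softmax (θt (k + 1)))) (lamt (k + 1)) i
        * (M.valueVec π i - M.valueVec (softmax (θt (k + 1))) i)
      + ∑ i, gradL Φ (M.valueVec (softmax (θt (k + 1)))) (lamt (k + 1)) i
        * (lamt (k + 1) i - l i)
    ≤ (α / (1 - M.γ) * M.policyKL π (softmax (θ k)) + kl l (lam k) / η'
        + β * (‖M.valueVec (softmax (θ k)) - M.valueVec (softmax (θt k))‖ ^ 2
          + l1 (lam k - lamt k) ^ 2))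
      - (α / (1 - M.γ) * M.policyKL π (softmax (θ (k + 1))) + kl l (lam (k + 1)) / η'
        + β * (‖M.valueVec (softmax (θ (k + 1))) - M.valueVec (softmax (θt (k + 1)))‖ ^ 2
          + l1 (lam (k + 1) - lamt (k + 1)) ^ 2))
      + 2 * (M.γ ^ n * (2 * L) / (1 - M.γ) ^ 2) := by
  have hm0 := hrun.lamt_mem hΦ hk.le
  have hm1 := hrun.lamt_mem hΦ (k := k + 1) hk
  obtain ⟨hlam, hsupp⟩ := hrun.lam_support hΦ hη' hk.le
  have hP := M.primal_step hβ hα hη (hL _ (hD (θt k)) _ hm0) (hL _ (hD (θt (k + 1))) _ hm1) n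
    (ht k ▸ hrun.step_tilde k hk) (ht k ▸ hrun.step k hk) hπ
  have hQ := dual_step hΦ.dual_subset hΦ.dual_convex hlam hsupp hη' hβ hη'β
    (hrun.step_lamt k hk) (hrun.step_lam k hk) hl
  have hS := hΦ.smooth _ (hD (θt (k + 1))) _ hm1 _ (hD (θt k)) _ hm0
  have hV : ‖M.valueVec (softmax (θt (k + 1))) - M.valueVec (softmax (θt k))‖
      ≤ ‖M.valueVec (softmax (θt (k + 1))) - M.valueVec (softmax (θ k))‖
        + ‖M.valueVec (softmax (θ k)) - M.valueVec (softmax (θt k))‖ :=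
    norm_sub_le_norm_sub_add_norm_sub _ _ _
  have hl1 : l1 (lamt (k + 1) - lamt k) ≤ l1 (lamt (k + 1) - lam k) + l1 (lam k - lamt k) := by
    rw [← sub_add_sub_cancel (lamt (k + 1)) (lam k) (lamt k)]
    exact l1_add_le _ _
  have n1 := norm_nonneg (M.valueVec (softmax (θ (k + 1))) - M.valueVec (softmax (θt (k + 1))))
  have n2 := l1_nonneg (lam (k + 1) - lamt (k + 1))
  generalize ‖M.valueVec (softmax (θ (k + 1))) - M.valueVec (softmax (θt (k + 1)))‖ = b₁ at *
  generalize l1 (lam (k + 1) - lamt (k + 1)) = b₁' at *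
  generalize ‖M.valueVec (softmax (θt (k + 1))) - M.valueVec (softmax (θ k))‖ = a at *
  generalize l1 (lamt (k + 1) - lam k) = a' at *
  generalize ‖M.valueVec (softmax (θ k)) - M.valueVec (softmax (θt k))‖ = b at *
  generalize l1 (lam k - lamt k) = b' at *
  have hS1 : max (l1 (gradV Φ (M.valueVec (softmax (θt (k + 1)))) (lamt (k + 1))
      - gradV Φ (M.valueVec (softmax (θt k))) (lamt k)))
      ‖gradL Φ (M.valueVec (softmax (θt (k + 1)))) (lamt (k + 1))
      - gradL Φ (M.valueVec (softmax (θt k))) (lamt k)‖ ≤ β * (a + b + a' + b') :=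
    hS.trans (mul_le_mul_of_nonneg_left (by linarith) hβ.le)
  have hS2 := mul_le_mul_of_nonneg_right ((le_max_left _ _).trans hS1) n1
  have hS3 := mul_le_mul_of_nonneg_right ((le_max_right _ _).trans hS1) n2
  -- Each of the eight products is at most half the sum of the two squares, which costs `2` on `b₁ ^
  -- 2` and `b₁' ^ 2`. Of the available `3`, the remaining `1` enters the potential and pays for `b
  -- ^ 2 + b' ^ 2` at the next macro step.
  have hq : (a + b + a' + b') * b₁ + (a + b + a' + b') * b₁' ≤ 3 * a ^ 2 + 3 * a' ^ 2
      + 3 * b₁ ^ 2 + 3 * b₁' ^ 2 + (b ^ 2 + b' ^ 2) - (b₁ ^ 2 + b₁' ^ 2) := by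
    nlinarith [sq_nonneg (a - b₁), sq_nonneg (a' - b₁), sq_nonneg (b - b₁), sq_nonneg (b' - b₁),
      sq_nonneg (a - b₁'), sq_nonneg (a' - b₁'), sq_nonneg (b - b₁'), sq_nonneg (b' - b₁'),
      sq_nonneg a, sq_nonneg a']
  have hq' := mul_le_mul_of_nonneg_left hq hβ.le
  rw [sub_div] at hQ
  linarith

theorem IsRun.minOver_sub_le [Nonempty A] (hrun : IsRun M Φ Λ η' α η t K θ θt lam lamt)
    (hΦ : IsCriterion Φ D Λ β) (hD : ∀ θ : S × A → ℝ, M.valueVec (softmax θ) ∈ D)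
    (hL : ∀ v ∈ D, ∀ l ∈ stdSimplex ℝ (Fin m), l1 (gradV Φ v l) ≤ L) (hβ : 0 < β)
    (hη' : 0 < η') (hη'β : η' ≤ 1 / (6 * β)) (hα : 6 * β / (1 - M.γ) ^ 3 ≤ α)
    (hη : η = (1 - M.γ) / α) {n : ℕ} (ht : ∀ k, t k = n + 1) (hK : 1 ≤ K) {π : S → A → ℝ}
    (hπ : IsPolicy π) (hπD : M.valueVec π ∈ D) :
    minOver Φ Λ (M.valueVec π)
        - minOver Φ Λ ((1 / (K : ℝ)) • ∑ k ∈ Icc 1 K, M.valueVec (softmax (θt k)))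
      ≤ (α / (1 - M.γ) * Real.log (Fintype.card A) + Real.log m / η'
        + K * (2 * (M.γ ^ n * (2 * L) / (1 - M.γ) ^ 2))) / K := by
  have hα0 : 0 < α := lt_of_lt_of_le (div_pos (by positivity) (pow_pos M.one_sub_γ_pos 3)) hα
  have hc : 0 < α / (1 - M.γ) := div_pos hα0 M.one_sub_γ_pos
  refine hΦ.minOver_sub_le hK hπD (w := fun k => M.valueVec (softmax (θt k))) (l := lamt)
    (fun k _ => hD _) (fun k hk => ?_) fun l hl => ?_
  · obtain ⟨h1, h2⟩ := mem_Icc.1 hk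
    obtain ⟨k, rfl⟩ := Nat.exists_eq_add_of_le' h1
    exact (hrun.step_lamt k h2).1
  rw [sum_Icc_one_eq_sum_range]
  refine (sum_le_sum fun k hk => hrun.step_regret_le hΦ hD hL hβ hη' hη'β hα hη ht hπ hl
    (mem_range.1 hk)).trans ?_
  rw [sum_add_distrib, sum_range_sub', sum_const, card_range, nsmul_eq_mul]
  have h1 := mul_le_mul_of_nonneg_left (M.policyKL_uniform_le hπ hrun.init_uniform) hc.le
  have h2 : kl l (lam 0) ≤ Real.log m := by
    have := kl_uniform_le (y := lam 0) (hΦ.dual_subset hl) fun i => by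
      rw [hrun.init_lam, Fintype.card_fin]
    rwa [Fintype.card_fin] at this
  have h2 := div_le_div_of_nonneg_right h2 hη'.le
  have h3 := mul_nonneg hc.le (M.policyKL_nonneg hπ (isPolicy_softmax (θ K)) (softmax_pos (θ K)))
  obtain ⟨h4, h5⟩ := hrun.lam_support hΦ hη' le_rfl
  have h6 := div_nonneg (kl_nonneg (hΦ.dual_subset hl) h4 (h5 l hl)) hη'.le
  -- Both copies of the iterates start together, so the potential has no quadratic part at `0`.
  have h7 : ‖M.valueVec (softmax (θ 0)) - M.valueVec (softmax (θt 0))‖ ^ 2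
      + l1 (lam 0 - lamt 0) ^ 2 = 0 := by
    rw [hrun.init_tilde, hrun.init_lam, hrun.init_lamt]; simp [l1]
  rw [h7, mul_zero, add_zero]
  have h8 : 0 ≤ β * (‖M.valueVec (softmax (θ K)) - M.valueVec (softmax (θt K))‖ ^ 2
      + l1 (lam K - lamt K) ^ 2) := by positivity
  linarith

end Run

/-! ### The number of micro steps -/

/-- Uses `γ ≤ exp (-(1 - γ))`. The `+ 1` in `microSteps` is the final micro step, which
`innerLoop_spec` does not count in the exponent. -/
theorem pow_mul_le_of_microSteps {γ L β : ℝ} (hγ0 : 0 < γ) (hγ1 : γ < 1) (hL : 0 < L)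
    (hβ : 0 < β) {nA K n : ℕ} (hA : 2 ≤ nA) (hK : 1 ≤ K) (h : microSteps γ L β nA K = n + 1) :
    γ ^ n * L ≤ 6 * β * Real.log nA / (5 * K) := by
  have hδ : 0 < 1 - γ := by linarith
  have hlog : 0 < Real.log nA := Real.log_pos (by exact_mod_cast hA)
  have hK0 : (0 : ℝ) < K := by exact_mod_cast hK
  have hX : 0 < 5 * L * K / (6 * β * Real.log nA) := by positivity
  have h1 : 1 / (1 - γ) * Real.log (5 * L * K / (6 * β * Real.log nA)) + 1 ≤ (n : ℝ) + 1 := by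
    have := Nat.le_ceil (1 / (1 - γ) * Real.log (5 * L * K / (6 * β * Real.log nA)) + 1)
    rw [microSteps] at h
    rw [h] at this
    exact_mod_cast this
  have h2 : Real.log (5 * L * K / (6 * β * Real.log nA)) ≤ n * (1 - γ) := by
    rw [one_div_mul_eq_div, add_le_add_iff_right, div_le_iff₀ hδ] at h1
    exact h1
  have h3 : γ ^ n ≤ Real.exp (-(n * (1 - γ))) := by
    have := Real.one_sub_le_exp_neg (1 - γ)
    rw [sub_sub_cancel] at this
    calc γ ^ n ≤ Real.exp (-(1 - γ)) ^ n := pow_le_pow_left₀ hγ0.le this n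
      _ = _ := by rw [← Real.exp_nat_mul]; congr 1; ring
  have h4 : γ ^ n ≤ (5 * L * K / (6 * β * Real.log nA))⁻¹ := by
    rw [← Real.exp_log (inv_pos.2 hX), Real.log_inv]
    exact h3.trans (Real.exp_le_exp.2 (neg_le_neg h2))
  calc γ ^ n * L ≤ (5 * L * K / (6 * β * Real.log nA))⁻¹ * L := mul_le_mul_of_nonneg_right h4 hL.le
    _ = _ := by field_simp

/-- Positivity excludes truncation at `0`, so the ceiling exceeds its argument by less than one. -/
theorem microSteps_le {γ L β : ℝ} (hγ0 : 0 < γ) (hγ1 : γ < 1) (hL : 0 < L)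
    (hβ : 0 < β) {nA K : ℕ} (hA : 2 ≤ nA) (hK : 1 ≤ K) (h : 0 < microSteps γ L β nA K) :
    (microSteps γ L β nA K : ℝ)
      ≤ (Real.posLog (L / β) + Real.log K + |Real.log (5 / (6 * Real.log nA))| + 2) / (1 - γ) := by
  have hδ : 0 < 1 - γ := by linarith
  have hlog : 0 < Real.log nA := Real.log_pos (by exact_mod_cast hA)
  have hK0 : (0 : ℝ) < K := by exact_mod_cast hK
  have h1 : (microSteps γ L β nA K : ℝ)
      < 1 / (1 - γ) * Real.log (5 * L * K / (6 * β * Real.log nA)) + 1 + 1 :=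
    Nat.ceil_lt_add_one (Nat.ceil_pos.1 h).le
  have e : 5 * L * K / (6 * β * Real.log nA) = L / β * K * (5 / (6 * Real.log nA)) := by
    field_simp
  rw [e, Real.log_mul (by positivity) (by positivity), Real.log_mul (by positivity) (by positivity)]
    at h1
  have h2 : Real.log (L / β) ≤ Real.posLog (L / β) := le_max_right _ _
  have h3 := le_abs_self (Real.log (5 / (6 * Real.log nA)))
  rw [le_div_iff₀ hδ]
  rw [one_div_mul_eq_div] at h1
  have h4 := mul_le_mul_of_nonneg_right h1.le hδ.le
  rw [add_mul, add_mul, div_mul_cancel₀ _ hδ.ne'] at h4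
  nlinarith

end ARNPG

/-! ### From the rate in `K` to the rate in `T` -/

theorem corollary3 (nA m : ℕ) (hA : 2 ≤ nA) (c : ℝ) (hc : 1 ≤ c) :
    ∃ C : ℝ, 0 < C ∧
      ∀ (S : Type*) (A : Type*) [Fintype S] [Fintype A], Fintype.card A = nA →
      ∀ (M : ARNPG.MOMDP S A m)
        (Φ : (Fin m → ℝ) → (Fin m → ℝ) → ℝ) (D Λ : Set (Fin m → ℝ)) (β L : ℝ),
      0 < β → 0 < L →
      (∀ θ : S × A → ℝ, M.valueVec (ARNPG.softmax θ) ∈ D) →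
      ARNPG.IsCriterion Φ D Λ β →
      (∀ v ∈ D, ∀ l ∈ stdSimplex ℝ (Fin m), ARNPG.l1 (ARNPG.gradV Φ v l) ≤ L) →
      ∀ (K : ℕ) (η' α η : ℝ), 1 ≤ K →
      1 / (c * (6 * β)) ≤ η' → η' ≤ 1 / (6 * β) →
      6 * β / (1 - M.γ) ^ 3 ≤ α → α ≤ c * (6 * β / (1 - M.γ) ^ 3) →
      η = (1 - M.γ) / α →
      ∀ (t : ℕ → ℕ), (∀ k, t k = ARNPG.microSteps M.γ L β nA K) →
      ∀ (θ θt : ℕ → S × A → ℝ) (lam lamt : ℕ → Fin m → ℝ),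
      ARNPG.IsRun M Φ Λ η' α η t K θ θt lam lamt →
      ∀ (T : ℕ), T = ∑ k ∈ Finset.range K, 2 * t k → 0 < T →
      ∀ π : S → A → ℝ, ARNPG.IsPolicy π → M.valueVec π ∈ D →
        ARNPG.minOver Φ Λ (M.valueVec π)
            - ARNPG.minOver Φ Λ
                ((1 / (K : ℝ)) • ∑ k ∈ Finset.Icc 1 K, M.valueVec (ARNPG.softmax (θt k)))
          ≤ C * (1 + Real.posLog (L / β)) * (β * Real.log T / ((1 - M.γ) ^ 5 * T)) ∧
        (L / β ≤ K →
          ARNPG.minOver Φ Λ (M.valueVec π)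
              - ARNPG.minOver Φ Λ
                  ((1 / (K : ℝ)) • ∑ k ∈ Finset.Icc 1 K, M.valueVec (ARNPG.softmax (θt k)))
            ≤ C * (β * Real.log T / ((1 - M.γ) ^ 5 * T))) := by
  have hlA : 0 < Real.log nA := Real.log_pos (by exact_mod_cast hA)
  have hlm : 0 ≤ Real.log m := Real.log_natCast_nonneg m
  have hl2 : 0 < Real.log 2 := Real.log_pos one_lt_two
  have hc0 : 0 < c := by linarith
  set κ := |Real.log (5 / (6 * Real.log nA))| with hκ
  have hκ0 : 0 ≤ κ := abs_nonneg _
  -- The terms pay for the initial policy divergence, the initial dual divergence and the inner-loop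
  -- errors, the last with `24 / 5` rounded up to `5`.
  set C₁ := 6 * c * Real.log nA + 6 * c * Real.log m + 5 * Real.log nA with hC₁
  have hC₁0 : 0 < C₁ := by positivity
  -- The `2` covers two logarithms bounded by `log T`; the other term absorbs constants through `T ≥
  -- 2`.
  set C₂ := 2 + (κ + 3) / Real.log 2 with hC₂
  have hC₂0 : 0 < C₂ := by positivity
  refine ⟨2 * C₁ * C₂, by positivity, ?_⟩
  intro S A _ _ hcard M Φ D Λ β L hβ hL hD hΦ hgrad K η' α η hK hη'1 hη'2 hα1 hα2 hη t ht θ θt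
    lam lamt hrun T hT hTpos π hπ hπD
  have hδ := M.one_sub_γ_pos
  have hδ1 : 1 - M.γ < 1 := by linarith [M.γ_pos]
  have : Nonempty A := Fintype.card_pos_iff.1 (by omega)
  have hK0 : (0 : ℝ) < K := by exact_mod_cast hK
  have hη' : 0 < η' := lt_of_lt_of_le (by positivity) hη'1
  set N := ARNPG.microSteps M.γ L β nA K with hN
  have hTN : T = K * (2 * N) := by rw [hT]; simp [ht]
  have hNpos : 0 < N := by
    rcases Nat.eq_zero_or_pos N with h | h
    · rw [h] at hTN; omega
    · exact h
  obtain ⟨n, hn⟩ : ∃ n, N = n + 1 := ⟨N - 1, by omega⟩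
  have hTN' : (T : ℝ) = K * (2 * N) := by exact_mod_cast hTN
  have hN0 : (0 : ℝ) < N := by exact_mod_cast hNpos
  have hT0 : (0 : ℝ) < T := by exact_mod_cast hTpos
  have hlogT2 : Real.log 2 ≤ Real.log T := by
    refine Real.log_le_log two_pos ?_
    have : 2 ≤ T := by rw [hTN]; nlinarith
    exact_mod_cast this
  have hlogTK : Real.log K ≤ Real.log T := by
    refine Real.log_le_log hK0 ?_
    have : K ≤ T := by rw [hTN]; nlinarith
    exact_mod_cast this
  have hmain := hrun.minOver_sub_le hΦ hD hgrad hβ hη' hη'2 hα1 hη (n := n)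
    (fun k => (ht k).trans hn) hK hπ hπD
  rw [hcard] at hmain
  set gap := ARNPG.minOver Φ Λ (M.valueVec π) - ARNPG.minOver Φ Λ
    ((1 / (K : ℝ)) • ∑ k ∈ Finset.Icc 1 K, M.valueVec (ARNPG.softmax (θt k)))
  have hgap : gap ≤ C₁ * β / (1 - M.γ) ^ 4 / K := by
    refine hmain.trans (div_le_div_of_nonneg_right ?_ hK0.le)
    have h1 : α / (1 - M.γ) * Real.log nA ≤ 6 * c * Real.log nA * β / (1 - M.γ) ^ 4 := by
      calc α / (1 - M.γ) * Real.log nA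
          ≤ c * (6 * β / (1 - M.γ) ^ 3) / (1 - M.γ) * Real.log nA :=
            mul_le_mul_of_nonneg_right (div_le_div_of_nonneg_right hα2 hδ.le) hlA.le
        _ = _ := by field_simp
    have h2 : Real.log m / η' ≤ 6 * c * Real.log m * β / (1 - M.γ) ^ 4 := by
      have h21 : 1 / η' ≤ c * (6 * β) := by
        rw [div_le_iff₀ hη']
        rwa [div_le_iff₀ (by positivity), mul_comm] at hη'1
      calc Real.log m / η' = Real.log m * (1 / η') := by ring
        _ ≤ Real.log m * (c * (6 * β)) := mul_le_mul_of_nonneg_left h21 hlm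
        _ = 6 * c * Real.log m * β := by ring
        _ ≤ _ := le_div_self (by positivity) (by positivity) (pow_le_one₀ hδ.le hδ1.le)
    have h3 : K * (2 * (M.γ ^ n * (2 * L) / (1 - M.γ) ^ 2))
        ≤ 5 * Real.log nA * β / (1 - M.γ) ^ 4 := by
      have h31 := ARNPG.pow_mul_le_of_microSteps M.γ_pos M.γ_lt_one hL hβ hA hK hn
      calc K * (2 * (M.γ ^ n * (2 * L) / (1 - M.γ) ^ 2))
          = 4 * K / (1 - M.γ) ^ 2 * (M.γ ^ n * L) := by ring
        _ ≤ 4 * K / (1 - M.γ) ^ 2 * (6 * β * Real.log nA / (5 * K)) :=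
            mul_le_mul_of_nonneg_left h31 (by positivity)
        _ = 24 / 5 * (Real.log nA * β) / (1 - M.γ) ^ 2 := by field_simp; ring
        _ ≤ 5 * Real.log nA * β / (1 - M.γ) ^ 2 :=
            div_le_div_of_nonneg_right (by nlinarith [mul_pos hlA hβ]) (by positivity)
        _ ≤ _ := div_le_div_of_nonneg_left (by positivity) (by positivity)
            (pow_le_pow_of_le_one hδ.le hδ1.le (by norm_num))
    calc _ ≤ 6 * c * Real.log nA * β / (1 - M.γ) ^ 4 + 6 * c * Real.log m * β / (1 - M.γ) ^ 4
          + 5 * Real.log nA * β / (1 - M.γ) ^ 4 := add_le_add (add_le_add h1 h2) h3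
      _ = _ := by rw [hC₁]; ring
  have hNle := ARNPG.microSteps_le M.γ_pos M.γ_lt_one hL hβ hA hK hNpos
  rw [← hN, ← hκ] at hNle
  -- Substituting `K = T / (2 N)` costs a factor `N`. The two claims take `X = 1 + log⁺ (L / β)`
  -- and, when `K ≥ L / β` lets `log K` absorb that logarithm, `X = 1`.
  have key : ∀ X : ℝ, Real.posLog (L / β) + Real.log K + κ + 2 ≤ C₂ * X * Real.log T →
      gap ≤ 2 * C₁ * C₂ * X * (β * Real.log T / ((1 - M.γ) ^ 5 * T)) := by
    intro X hX
    have h1 : (N : ℝ) ≤ C₂ * X * Real.log T / (1 - M.γ) :=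
      hNle.trans (div_le_div_of_nonneg_right hX hδ.le)
    calc gap ≤ C₁ * β / (1 - M.γ) ^ 4 / K := hgap
      _ = 2 * C₁ * β / ((1 - M.γ) ^ 4 * T) * N := by rw [hTN']; field_simp
      _ ≤ 2 * C₁ * β / ((1 - M.γ) ^ 4 * T) * (C₂ * X * Real.log T / (1 - M.γ)) :=
          mul_le_mul_of_nonneg_left h1 (by positivity)
      _ = _ := by field_simp
  have hconst : κ + 3 ≤ (κ + 3) / Real.log 2 * Real.log T := by
    rw [div_mul_eq_mul_div, le_div_iff₀ hl2]
    exact mul_le_mul_of_nonneg_left hlogT2 (by linarith)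
  have hT1 : 0 < Real.log T := hl2.trans_le hlogT2
  constructor
  · refine key _ ?_
    have hp : 0 ≤ Real.posLog (L / β) := le_max_left _ _
    rw [hC₂]
    nlinarith [mul_nonneg hp (sub_nonneg.2 hconst), mul_nonneg hp hT1.le, mul_nonneg hp hκ0]
  · intro hKL
    have hp : Real.posLog (L / β) ≤ Real.log K := by
      refine max_le (Real.log_natCast_nonneg K) ?_
      exact Real.log_le_log (by positivity) hKL
    have := key 1 (by rw [hC₂]; linarith)
    rwa [mul_one] at this
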